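/- Let $k\in\mathbb N=\{0,1,2,\dots\}$ and let $X\subset\mathbb R^N$ be a smooth real affine algebraic variety of dimension $d\ge 2$. That is, $X$ is the set of common real zeros of a family of polynomials in $\mathbb R[x_1,\dots,x_N]$, the coordinate ring $\mathbb R[x_1,\dots,x_N]/\mathcal I(X)$, where $\mathcal I(X)$ is the ideal of all polynomials vanishing on $X$, has Krull dimension $d$, and for every point $a\in X$ the localization $\mathcal O_{X,a}$ of this ring at the maximal ideal of $a$ is a regular local ring of dimension $d$. ($X$ need not be irreducible.) Let $\mathcal R^k(X)$ be the ring of $k$-regulous functions on $X$, i.e. of the functions $f:X\to\mathbb R$ that are of class $\mathcal C^k$ on the submanifold $X$ of $\mathbb R^N$ and rational, meaning that there are polynomials $p,q\in\mathbb R[x_1,\dots,x_N]$ such that $\{x\in X: q(x)\ne 0\}$ is Zariski dense in $X$ and $f=p/q$ on this set. Then no maximal ideal of $\mathcal R^k(X)$ is finitely generated. In particular, the ring $\mathcal R^k(X)$ is not noetherian. -/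

import Mathlib

noncomputable section

namespace Regulous

open MvPolynomial Topology

/-- `X ⊆ ℝ^N` is a real algebraic set: the set of common real zeros of a set of polynomials. -/
def IsAlgebraicSet {N : ℕ} (X : Set (Fin N → ℝ)) : Prop :=
  ∃ S : Set (MvPolynomial (Fin N) ℝ), X = {x | ∀ p ∈ S, eval x p = 0}

/-- The coordinate ring `ℝ[x₁, …, x_N] / I(X)`, where `I(X)` is the ideal of all polynomials
vanishing at every point of `X`. -/
abbrev CoordRing {N : ℕ} (X : Set (Fin N → ℝ)) : Type :=
  MvPolynomial (Fin N) ℝ ⧸ vanishingIdeal ℝ X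

/-- The dimension of a real algebraic set is the Krull dimension of its coordinate ring
(it is `⊥` for the empty set). -/
def dim {N : ℕ} (X : Set (Fin N → ℝ)) : WithBot ℕ∞ :=
  ringKrullDim (CoordRing X)

/-- Evaluation at a point `a ∈ X` on the coordinate ring. -/
def evalAt {N : ℕ} (X : Set (Fin N → ℝ)) (a : X) : CoordRing X →+* ℝ :=
  Ideal.Quotient.lift (vanishingIdeal ℝ X) (eval (a : Fin N → ℝ)) (fun p hp => by
    have h := hp (a : Fin N → ℝ) a.2
    rwa [aeval_eq_eval] at h)

/-- The ideal of a point `a ∈ X` in the coordinate ring. -/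
def pointIdeal {N : ℕ} (X : Set (Fin N → ℝ)) (a : X) : Ideal (CoordRing X) :=
  RingHom.ker (evalAt X a)

instance pointIdeal_isPrime {N : ℕ} (X : Set (Fin N → ℝ)) (a : X) : (pointIdeal X a).IsPrime :=
  RingHom.ker_isPrime (evalAt X a)

/-- The local ring `𝓞_{X,a}` of germs of regular functions at `a ∈ X`. -/
abbrev LocalRingAt {N : ℕ} (X : Set (Fin N → ℝ)) (a : X) : Type :=
  Localization.AtPrime (pointIdeal X a)

/-- `X` is smooth (nonsingular): at every point `a ∈ X`, the local ring `𝓞_{X,a}` is a regular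
local ring of dimension `dim X`.  (For irreducible `X` the equality of dimensions is automatic; in
general it says that all irreducible components of `X` have the same dimension.) -/
def IsSmooth {N : ℕ} (X : Set (Fin N → ℝ)) : Prop :=
  ∀ a : X, IsRegularLocalRing (LocalRingAt X a) ∧ ringKrullDim (LocalRingAt X a) = dim X

/-- `f : X → ℝ` is rational: it is a quotient `p / q` of polynomials on the Zariski open subset
`{q ≠ 0}` of `X`, which is Zariski dense in `X`. -/
def IsRational {N : ℕ} (X : Set (Fin N → ℝ)) (f : X → ℝ) : Prop :=
  ∃ p q : MvPolynomial (Fin N) ℝ,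
    (∀ r : MvPolynomial (Fin N) ℝ,
      (∀ x ∈ X, eval x q ≠ 0 → eval x r = 0) → ∀ x ∈ X, eval x r = 0) ∧
    ∀ x : X, eval (x : Fin N → ℝ) q ≠ 0 →
      f x = eval (x : Fin N → ℝ) p / eval (x : Fin N → ℝ) q

/-- `f : X → ℝ` is of class `𝓒ᵏ` on the submanifold `X ⊆ ℝ^N`: near each point of `X` it is the
restriction of a `𝓒ᵏ` function of the ambient space. -/
def IsCk {N : ℕ} (k : ℕ) (X : Set (Fin N → ℝ)) (f : X → ℝ) : Prop :=
  ∀ a : X, ∃ F : (Fin N → ℝ) → ℝ, ContDiffAt ℝ k F (a : Fin N → ℝ) ∧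
    ∀ᶠ x : X in 𝓝 a, f x = F x

theorem isRational_const {N : ℕ} (X : Set (Fin N → ℝ)) (c : ℝ) :
    IsRational X (fun _ => c) :=
  ⟨C c, 1, fun r h x hx => h x hx (by simp), fun x _ => by simp⟩

/-- Intersections of two dense principal Zariski open subsets are dense. -/
theorem dense_mul {N : ℕ} {X : Set (Fin N → ℝ)} {q s : MvPolynomial (Fin N) ℝ}
    (hq : ∀ r : MvPolynomial (Fin N) ℝ,
      (∀ x ∈ X, eval x q ≠ 0 → eval x r = 0) → ∀ x ∈ X, eval x r = 0)
    (hs : ∀ r : MvPolynomial (Fin N) ℝ,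
      (∀ x ∈ X, eval x s ≠ 0 → eval x r = 0) → ∀ x ∈ X, eval x r = 0)
    (r : MvPolynomial (Fin N) ℝ)
    (h : ∀ x ∈ X, eval x (q * s) ≠ 0 → eval x r = 0) : ∀ x ∈ X, eval x r = 0 := by
  have h1 : ∀ x ∈ X, eval x (r * s) = 0 := by
    refine hq _ fun x hx hqx => ?_
    by_cases hsx : eval x s = 0
    · simp [hsx]
    · rw [map_mul, h x hx (by rw [map_mul]; exact mul_ne_zero hqx hsx), zero_mul]
  refine hs r fun x hx hsx => ?_
  have h2 := h1 x hx
  rw [map_mul] at h2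
  exact (mul_eq_zero.1 h2).resolve_right hsx

theorem IsRational.add {N : ℕ} {X : Set (Fin N → ℝ)} {f g : X → ℝ}
    (hf : IsRational X f) (hg : IsRational X g) : IsRational X (f + g) := by
  obtain ⟨p, q, hq, hpq⟩ := hf
  obtain ⟨p', q', hq', hpq'⟩ := hg
  refine ⟨p * q' + q * p', q * q', dense_mul hq hq', fun x hx => ?_⟩
  rw [map_mul] at hx
  have h1 := left_ne_zero_of_mul hx
  have h2 := right_ne_zero_of_mul hx
  simp only [Pi.add_apply, map_add, map_mul]
  rw [hpq x h1, hpq' x h2, div_add_div _ _ h1 h2]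

theorem IsRational.mul {N : ℕ} {X : Set (Fin N → ℝ)} {f g : X → ℝ}
    (hf : IsRational X f) (hg : IsRational X g) : IsRational X (f * g) := by
  obtain ⟨p, q, hq, hpq⟩ := hf
  obtain ⟨p', q', hq', hpq'⟩ := hg
  refine ⟨p * p', q * q', dense_mul hq hq', fun x hx => ?_⟩
  rw [map_mul] at hx
  have h1 := left_ne_zero_of_mul hx
  have h2 := right_ne_zero_of_mul hx
  simp only [Pi.mul_apply, map_mul]
  rw [hpq x h1, hpq' x h2, div_mul_div_comm]

theorem isCk_const {N : ℕ} (k : ℕ) (X : Set (Fin N → ℝ)) (c : ℝ) : IsCk k X (fun _ => c) :=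
  fun _ => ⟨fun _ => c, contDiffAt_const, Filter.Eventually.of_forall fun _ => rfl⟩

theorem IsCk.add {N k : ℕ} {X : Set (Fin N → ℝ)} {f g : X → ℝ}
    (hf : IsCk k X f) (hg : IsCk k X g) : IsCk k X (f + g) := by
  intro a
  obtain ⟨F, hF, hfF⟩ := hf a
  obtain ⟨G, hG, hgG⟩ := hg a
  refine ⟨fun x => F x + G x, hF.add hG, ?_⟩
  filter_upwards [hfF, hgG] with x h1 h2
  simp [h1, h2]

theorem IsCk.mul {N k : ℕ} {X : Set (Fin N → ℝ)} {f g : X → ℝ}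
    (hf : IsCk k X f) (hg : IsCk k X g) : IsCk k X (f * g) := by
  intro a
  obtain ⟨F, hF, hfF⟩ := hf a
  obtain ⟨G, hG, hgG⟩ := hg a
  refine ⟨fun x => F x * G x, hF.mul hG, ?_⟩
  filter_upwards [hfF, hgG] with x h1 h2
  simp [h1, h2]

/-- The ring `𝓡ᵏ(X)` of `k`-regulous functions on `X`: real-valued functions on `X` which are
rational and of class `𝓒ᵏ`, with pointwise operations. -/
def regulousRing {N : ℕ} (k : ℕ) (X : Set (Fin N → ℝ)) : Subalgebra ℝ (X → ℝ) where
  carrier := {f | IsRational X f ∧ IsCk k X f}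
  mul_mem' hf hg := ⟨hf.1.mul hg.1, hf.2.mul hg.2⟩
  add_mem' hf hg := ⟨hf.1.add hg.1, hf.2.add hg.2⟩
  algebraMap_mem' c := ⟨isRational_const X c, isCk_const k X c⟩

end Regulous

end

/-!
The ring `𝓡ᵏ(X)` has an evaluation map at every point `a` of `X`, with kernel `𝔪`. A finitely
generated proper ideal has a common zero, since the sum of the squares of its generators would
otherwise be invertible (`exists_le_ker_evalRegulous`). Hence a finitely generated maximal ideal
is one of these kernels `𝔪`, and `𝔪 / 𝔪²` is then a finite-dimensional real vector space
(`exists_sum_smul_mem_sq_of_fg`). It has infinite dimension, for the following reason.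

Near the regular point `a` the set `X` has an analytic chart `φ` with `φ 0 = a`, inverse to `d`
parameters `u` (`exists_chart`). A regulous function `f` is a quotient of polynomials and
continuous, so for almost every direction `v` the function `t ↦ f (φ (t v))` is analytic at `0`, and
since `f` is of class `𝓒ᵏ`, its Taylor coefficients of order at most `k` are polynomials in `v`
(`hasTaylorAlongLines_of_mem_regulousRing`). In a product of two elements of `𝔪` the constant terms
vanish, so that the coefficient of order `k + 1` only involves coefficients of order at most `k` of
the factors: for elements of `𝔪²` this coefficient is a polynomial in `v` as well
(`hasTaylorAlongLines_of_mem_ker_mul_ker`). On the other hand, with `u₀` one of the parameters, the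
functions `u₀ ^ (2 j + k + 1) / |x - a| ^ (2 j)` for `j ≥ 1` are in `𝔪`, and their coefficients of
order `k + 1` are `v₀ ^ (2 j + k + 1) / q(v) ^ j`, where `q(v)` is the squared norm of the
derivative of `φ` in direction `v`. No nontrivial linear combination of these is a polynomial, since
`q` would then divide a power of `v₀`; because `d ≥ 2`, the form `q` is positive at some `v ≠ 0`
with `v₀ = 0` (`not_hasTaylorAlongLines_sum`).

The chart comes from the inverse function theorem. Choose polynomials `h` vanishing on `X` whose
gradients at `a` form a basis of the gradients of all polynomials vanishing on `X`, and complete by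
linear forms `u`; regularity gives exactly `d` of these, and they generate the maximal ideal of
`𝓞_{X,a}` (`exists_parameters`). Modulo `h`, every polynomial of order `n` at `a` has a leading form
in `u` (`exists_homogeneous_sub_mem`), and this form is determined in `𝓞_{X,a}`, because parameters
of a regular local ring are analytically independent (`eq_zero_of_aeval_mem_of_isHomogeneous`).
Together with Krull's intersection theorem this shows that `h` defines `X` near `a`, and that a
polynomial which is not a zero divisor on `X` does not vanish identically along the chart.
-/

noncomputable section

namespace Regulous

open MvPolynomial Topology

/-! ### Analytic independence of parameters -/

theorem aeval_mul_of_isHomogeneous {σ A : Type*} [Fintype σ] [CommRing A] [Algebra ℝ A]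
    {G : MvPolynomial σ ℝ} {n : ℕ} (hG : G.IsHomogeneous n) (b : σ → ℝ) (x : A) :
    aeval (fun j => algebraMap ℝ A (b j) * x) G = algebraMap ℝ A (eval b G) * x ^ n := by
  rw [aeval_def, eval₂_eq', eval_eq', map_sum, Finset.sum_mul]
  refine Finset.sum_congr rfl fun s hs => ?_
  simp only [mul_pow, Finset.prod_mul_distrib, Finset.prod_pow_eq_pow_sum, map_mul, map_prod,
    map_pow]
  have : ∑ i, s i = n := by
    rw [hG.degree_eq_sum_deg_support hs]
    exact (Finset.sum_subset (Finset.subset_univ _) fun i _ hi => by simpa using hi).symm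
  rw [this, mul_assoc]

theorem eval_smul_of_isHomogeneous {σ : Type*} [Fintype σ]
    {G : MvPolynomial σ ℝ} {n : ℕ} (hG : G.IsHomogeneous n) (b : σ → ℝ) (t : ℝ) :
    eval (t • b) G = t ^ n * eval b G := by
  have h := aeval_mul_of_isHomogeneous (A := ℝ) hG b t
  rw [aeval_eq_eval] at h
  simpa [mul_comm, Pi.smul_def] using h

theorem aeval_mem_pow_of_isHomogeneous {σ A : Type*} [Fintype σ] [CommRing A] [Algebra ℝ A]
    {I : Ideal A} {u : σ → A} (hu : ∀ i, u i ∈ I) {G : MvPolynomial σ ℝ} {n : ℕ}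
    (hG : G.IsHomogeneous n) : aeval u G ∈ I ^ n := by
  rw [aeval_def, eval₂_eq']
  refine Ideal.sum_mem _ fun s hs => Ideal.mul_mem_left _ _ ?_
  have : ∑ i, s i = n := by
    rw [hG.degree_eq_sum_deg_support hs]
    exact (Finset.sum_subset (Finset.subset_univ _) fun i _ hi => by simpa using hi).symm
  rw [← this, ← Finset.prod_pow_eq_pow_sum]
  exact Ideal.prod_mem_prod fun i _ => Ideal.pow_mem_pow (hu i) _

/-- Parameters of a regular local ring are analytically independent. If a nonzero form `G` of
degree `n` satisfied `G(u) ∈ 𝔪 ^ (n + 1)`, choose `c` with `G(c) ≠ 0` and `c i₀ ≠ 0`, and let `K` be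
generated by the `d - 1` elements `u j - (c j / c i₀) u i₀`. Modulo `K` everything is a multiple of
`u i₀`, and the relation makes `u i₀` nilpotent, so `𝔪` is minimal over `K`, against Krull's height
theorem. -/
theorem eq_zero_of_aeval_mem_of_isHomogeneous {O : Type*} [CommRing O] [IsLocalRing O]
    [IsNoetherianRing O] [Algebra ℝ O] {d : ℕ} {u : Fin d → O}
    (hu : Ideal.span (Set.range u) = IsLocalRing.maximalIdeal O)
    (hd : (d : WithBot ℕ∞) ≤ ringKrullDim O) {n : ℕ} {G : MvPolynomial (Fin d) ℝ}
    (hG : G.IsHomogeneous n) (h : aeval u G ∈ IsLocalRing.maximalIdeal O ^ (n + 1)) :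
    G = 0 := by
  classical
  by_contra hne
  obtain ⟨c, hc⟩ : ∃ c, eval c G ≠ 0 := by
    by_contra! hcon
    exact hne (MvPolynomial.funext fun x => by simpa using hcon x)
  have humem : ∀ i, u i ∈ IsLocalRing.maximalIdeal O := fun i => by
    rw [← hu]; exact Ideal.subset_span ⟨i, rfl⟩
  rcases Nat.eq_zero_or_pos n with rfl | hn
  · have hG0 := (totalDegree_zero_iff_isHomogeneous _).2 hG
    rw [totalDegree_eq_zero_iff_eq_C] at hG0
    rw [hG0] at h hc
    simp only [aeval_C, zero_add, pow_one, eval_C] at h hc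
    exact (IsLocalRing.mem_maximalIdeal _).1 h ((IsUnit.mk0 _ hc).map (algebraMap ℝ O))
  obtain ⟨i₀, hi₀⟩ : ∃ i, c i ≠ 0 := by
    by_contra! hcon
    have h0 := eval_smul_of_isHomogeneous hG c 0
    have : (0 : ℝ) • c = c := by ext i; simp [hcon i]
    rw [this, zero_pow hn.ne', zero_mul] at h0
    exact hc h0
  set b : Fin d → ℝ := (c i₀)⁻¹ • c with hb
  have hbG : eval b G ≠ 0 := by
    rw [hb, eval_smul_of_isHomogeneous hG]
    exact mul_ne_zero (pow_ne_zero _ (inv_ne_zero hi₀)) hc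
  set x := u i₀ with hx
  set S : Finset O := (Finset.univ.erase i₀).image (fun j => u j - algebraMap ℝ O (b j) * x)
  have hcard : S.card ≤ d - 1 := by
    refine Finset.card_image_le.trans ?_
    simp
  set K : Ideal O := Ideal.span (S : Set O) with hK
  have hKu : ∀ j, u j - algebraMap ℝ O (b j) * x ∈ K := by
    intro j
    by_cases hj : j = i₀
    · subst hj
      simp [hb, hi₀, hx]
    · exact Ideal.subset_span (by
        simp only [S, Finset.coe_image, Set.mem_image]
        exact ⟨j, by simpa using hj, rfl⟩)
  let π := Ideal.Quotient.mkₐ ℝ K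
  have hπu : ∀ j, π (u j) = algebraMap ℝ (O ⧸ K) (b j) * π x := by
    intro j
    have := (Ideal.Quotient.mk_eq_mk_iff_sub_mem _ _).2 (hKu j)
    calc π (u j) = π (algebraMap ℝ O (b j) * x) := this
      _ = _ := by rw [map_mul, AlgHom.commutes]
  have hπG : π (aeval u G) = algebraMap ℝ (O ⧸ K) (eval b G) * π x ^ n := by
    rw [← aeval_mul_of_isHomogeneous hG, ← AlgHom.comp_apply, comp_aeval]
    congr 2
    ext j
    exact hπu j
  -- modulo `K` the maximal ideal is generated by the single element `x`
  have hmax : (IsLocalRing.maximalIdeal O).map (π : O →+* O ⧸ K) ≤ Ideal.span {π x} := by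
    rw [← hu, Ideal.map_span, Ideal.span_le]
    rintro _ ⟨_, ⟨j, rfl⟩, rfl⟩
    change π (u j) ∈ _
    rw [hπu j]
    exact Ideal.mul_mem_left _ _ (Ideal.mem_span_singleton_self _)
  have h2 : π (aeval u G) ∈ Ideal.span {π x ^ (n + 1)} := by
    rw [← Ideal.span_singleton_pow]
    refine Ideal.pow_right_mono hmax _ ?_
    rw [← Ideal.map_pow]
    exact Ideal.mem_map_of_mem (π : O →+* O ⧸ K) h
  obtain ⟨z, hz⟩ := Ideal.mem_span_singleton'.1 h2
  obtain ⟨z, rfl⟩ := Ideal.Quotient.mkₐ_surjective ℝ K z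
  have hxK : x ^ n ∈ K := by
    have h3 : (algebraMap ℝ O (eval b G) - z * x) * x ^ n ∈ K := by
      have : π ((algebraMap ℝ O (eval b G) - z * x) * x ^ n) = 0 := by
        rw [map_mul, map_sub, map_mul, map_pow, AlgHom.commutes, sub_mul, ← hπG, ← hz]
        change π z * _ - _ = 0
        ring
      exact Ideal.Quotient.eq_zero_iff_mem.1 this
    have hunit : IsUnit (algebraMap ℝ O (eval b G) - z * x) := by
      have h4 := (IsUnit.mk0 _ hbG).map (algebraMap ℝ O)
      by_contra h5
      have h6 : z * x ∈ IsLocalRing.maximalIdeal O := Ideal.mul_mem_left _ _ (humem i₀)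
      have h7 := Ideal.add_mem _ ((IsLocalRing.mem_maximalIdeal _).2 h5) h6
      rw [sub_add_cancel] at h7
      exact (IsLocalRing.mem_maximalIdeal _).1 h7 h4
    exact (Ideal.unit_mul_mem_iff_mem _ hunit).1 h3
  have hrad : IsLocalRing.maximalIdeal O ≤ K.radical := by
    rw [← hu, Ideal.span_le]
    rintro _ ⟨j, rfl⟩
    have := Ideal.add_mem _ (Ideal.le_radical (hKu j))
      (Ideal.mul_mem_left K.radical (algebraMap ℝ O (b j)) (show x ∈ K.radical from ⟨n, hxK⟩))
    simpa using this
  have hKm : K ≤ IsLocalRing.maximalIdeal O := by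
    rw [hK, Ideal.span_le]
    intro y hy
    simp only [S, Finset.coe_image, Set.mem_image] at hy
    obtain ⟨j, -, rfl⟩ := hy
    exact Ideal.sub_mem _ (humem j) (Ideal.mul_mem_left _ _ (humem i₀))
  have hmin : IsLocalRing.maximalIdeal O ∈ K.minimalPrimes := by
    refine ⟨⟨inferInstance, hKm⟩, fun q hq _ => ?_⟩
    exact hrad.trans (hq.1.radical_le_iff.2 hq.2)
  have hht := Ideal.height_le_card_of_mem_minimalPrimes_span_finset hmin
  rw [← IsLocalRing.maximalIdeal_height_eq_ringKrullDim] at hd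
  have hd' : (d : ℕ∞) ≤ (IsLocalRing.maximalIdeal O).height := by exact_mod_cast hd
  have : d ≤ d - 1 := by
    have := hd'.trans (hht.trans (by exact_mod_cast hcard : (S.card : ℕ∞) ≤ ((d - 1 : ℕ) : ℕ∞)))
    exact_mod_cast this
  have := i₀.2
  omega

/-! ### Leading forms of polynomials at a point -/

/-- The maximal ideal of the polynomial ring consisting of the polynomials vanishing at `a`. -/
def maxIdealAt {N : ℕ} (a : Fin N → ℝ) : Ideal (MvPolynomial (Fin N) ℝ) :=
  RingHom.ker (eval a)

theorem mem_maxIdealAt {N : ℕ} {a : Fin N → ℝ} {p : MvPolynomial (Fin N) ℝ} :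
    p ∈ maxIdealAt a ↔ eval a p = 0 := Iff.rfl

/-- The gradient at `a` of a polynomial. -/
def grad {N : ℕ} (a : Fin N → ℝ) : MvPolynomial (Fin N) ℝ →ₗ[ℝ] (Fin N → ℝ) :=
  LinearMap.pi fun i => (aeval a).toLinearMap ∘ₗ (pderiv i).toLinearMap

theorem grad_apply {N : ℕ} (a : Fin N → ℝ) (p : MvPolynomial (Fin N) ℝ) (i : Fin N) :
    grad a p i = eval a (pderiv i p) := by
  simp [grad, aeval_eq_eval]

theorem grad_mul {N : ℕ} (a : Fin N → ℝ) (p q : MvPolynomial (Fin N) ℝ) :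
    grad a (p * q) = eval a p • grad a q + eval a q • grad a p := by
  ext i
  simp [grad_apply, Derivation.leibniz]

theorem grad_C {N : ℕ} (a : Fin N → ℝ) (c : ℝ) : grad a (C c) = 0 := by
  ext i
  simp [grad_apply]

theorem grad_X {N : ℕ} (a : Fin N → ℝ) (k : Fin N) : grad a (X k) = Pi.single k 1 := by
  ext i
  rw [grad_apply, pderiv_X, Pi.single_apply, Pi.single_apply]
  simp only [eq_comm]
  split_ifs <;> simp

/-- The linear form `x ↦ ∑ k, v k * (x k - a k)`. -/
def linearForm {N : ℕ} (a v : Fin N → ℝ) : MvPolynomial (Fin N) ℝ :=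
  ∑ k, C (v k) * (X k - C (a k))

theorem linearForm_mem {N : ℕ} (a v : Fin N → ℝ) : linearForm a v ∈ maxIdealAt a := by
  simp [mem_maxIdealAt, linearForm]

theorem grad_linearForm {N : ℕ} (a v : Fin N → ℝ) : grad a (linearForm a v) = v := by
  ext i
  simp [linearForm, grad_mul, grad_C, grad_X, Pi.single_apply]

/-- Taylor's formula of order one at `a` for polynomials. -/
theorem sub_linearForm_grad_mem {N : ℕ} (a : Fin N → ℝ) (p : MvPolynomial (Fin N) ℝ) :
    p - C (eval a p) - linearForm a (grad a p) ∈ maxIdealAt a ^ 2 := by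
  induction p using MvPolynomial.induction_on with
  | C c => simp [grad_C, linearForm]
  | add p q hp hq =>
    have h : p + q - C (eval a (p + q)) - linearForm a (grad a (p + q)) =
        (p - C (eval a p) - linearForm a (grad a p)) +
        (q - C (eval a q) - linearForm a (grad a q)) := by
      simp only [linearForm, map_add, Pi.add_apply, add_mul, Finset.sum_add_distrib]
      ring
    rw [h]
    exact Ideal.add_mem _ hp hq
  | mul_X p i hp =>
    have h1 : linearForm a (grad a (p * X i)) =
        C (a i) * linearForm a (grad a p) + C (eval a p) * (X i - C (a i)) := by
      rw [grad_mul, grad_X, eval_X]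
      simp only [linearForm, Pi.add_apply, Pi.smul_apply, smul_eq_mul, map_add, map_mul, add_mul,
        Finset.sum_add_distrib, Finset.mul_sum]
      rw [add_comm]
      congr 1
      · simp only [mul_assoc]
      · rw [Finset.sum_eq_single i]
        · simp
        · intro k _ hk
          simp [hk]
        · simp
    have h : p * X i - C (eval a (p * X i)) - linearForm a (grad a (p * X i)) =
        C (a i) * (p - C (eval a p) - linearForm a (grad a p)) +
          (p - C (eval a p)) * (X i - C (a i)) := by
      rw [h1, map_mul, eval_X, map_mul]
      ring
    rw [h]
    refine Ideal.add_mem _ (Ideal.mul_mem_left _ _ hp) ?_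
    rw [pow_two]
    exact Ideal.mul_mem_mul (by simp [mem_maxIdealAt]) (by simp [mem_maxIdealAt])

theorem mem_sq_of_grad_eq_zero {N : ℕ} {a : Fin N → ℝ} {p : MvPolynomial (Fin N) ℝ}
    (hp : p ∈ maxIdealAt a) (h : grad a p = 0) : p ∈ maxIdealAt a ^ 2 := by
  simpa [h, mem_maxIdealAt.1 hp, linearForm] using sub_linearForm_grad_mem a p

section Expansion

variable {N d e : ℕ} {a : Fin N → ℝ} {u : Fin d → MvPolynomial (Fin N) ℝ}
  {h : Fin e → MvPolynomial (Fin N) ℝ}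

/-- If the gradients of `u` and `h` span `ℝ^N`, then `𝔪ₐ` consists of linear forms in `u`, up to
multiples of `h` and second order terms. -/
theorem exists_linear_sub_mem (hu : ∀ i, u i ∈ maxIdealAt a) (hh : ∀ j, h j ∈ maxIdealAt a)
    (hspan : ⊤ ≤ Submodule.span ℝ
      (Set.range (Sum.elim (fun i => grad a (u i)) fun j => grad a (h j))))
    {g : MvPolynomial (Fin N) ℝ} (hg : g ∈ maxIdealAt a) :
    ∃ G : MvPolynomial (Fin d) ℝ, G.IsHomogeneous 1 ∧
      g - aeval u G ∈ Ideal.span (Set.range h) ⊔ maxIdealAt a ^ 2 := by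
  obtain ⟨c, hc⟩ := (Submodule.mem_span_range_iff_exists_fun ℝ).1
    (hspan (Submodule.mem_top (x := grad a g)))
  rw [Fintype.sum_sum_type] at hc
  simp only [Sum.elim_inl, Sum.elim_inr] at hc
  refine ⟨∑ i, C (c (Sum.inl i)) * X i,
    IsHomogeneous.sum _ _ _ fun i _ => isHomogeneous_C_mul_X _ _, ?_⟩
  have hH : ∑ j, C (c (Sum.inr j)) * h j ∈ Ideal.span (Set.range h) :=
    Ideal.sum_mem _ fun j _ => Ideal.mul_mem_left _ _ (Ideal.subset_span ⟨j, rfl⟩)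
  have hU : aeval u (∑ i, C (c (Sum.inl i)) * X i) = ∑ i, C (c (Sum.inl i)) * u i := by
    simp [algebraMap_eq]
  rw [hU, Submodule.mem_sup]
  refine ⟨_, hH, g - ∑ i, C (c (Sum.inl i)) * u i - ∑ j, C (c (Sum.inr j)) * h j, ?_, by ring⟩
  refine mem_sq_of_grad_eq_zero ?_ ?_
  · refine Ideal.sub_mem _ (Ideal.sub_mem _ hg ?_) ?_
    · exact Ideal.sum_mem _ fun i _ => Ideal.mul_mem_left _ _ (hu i)
    · exact Ideal.sum_mem _ fun i _ => Ideal.mul_mem_left _ _ (hh i)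
  · simp only [map_sub, map_sum, grad_mul, grad_C, eval_C, smul_zero, add_zero]
    rw [← hc]
    abel

/-- The leading form: a polynomial of order `n` at `a` agrees with a form of degree `n` in `u`, up
to multiples of `h` and terms of order `n + 1`. -/
theorem exists_homogeneous_sub_mem (hu : ∀ i, u i ∈ maxIdealAt a) (hh : ∀ j, h j ∈ maxIdealAt a)
    (hspan : ⊤ ≤ Submodule.span ℝ
      (Set.range (Sum.elim (fun i => grad a (u i)) fun j => grad a (h j))))
    (n : ℕ) {g : MvPolynomial (Fin N) ℝ} (hg : g ∈ maxIdealAt a ^ n) :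
    ∃ G : MvPolynomial (Fin d) ℝ, G.IsHomogeneous n ∧
      g - aeval u G ∈ Ideal.span (Set.range h) ⊔ maxIdealAt a ^ (n + 1) := by
  induction n generalizing g with
  | zero =>
    refine ⟨C (eval a g), isHomogeneous_C _ _, Ideal.mem_sup_right ?_⟩
    simp [mem_maxIdealAt, algebraMap_eq]
  | succ n ih =>
    rw [pow_succ'] at hg
    refine Submodule.mul_induction_on hg (fun x hx y hy => ?_) fun x y hx hy => ?_
    · obtain ⟨G, hG, hxG⟩ := exists_linear_sub_mem hu hh hspan hx
      obtain ⟨H, hH, hyH⟩ := ih hy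
      refine ⟨G * H, by rw [add_comm]; exact hG.mul hH, ?_⟩
      obtain ⟨j, hj, z, hz, hjz⟩ := Submodule.mem_sup.1 hxG
      obtain ⟨j', hj', z', hz', hjz'⟩ := Submodule.mem_sup.1 hyH
      have hGm : aeval u G ∈ maxIdealAt a := by
        simpa using aeval_mem_pow_of_isHomogeneous hu hG
      have key : x * y - aeval u (G * H) =
          (j * y + aeval u G * j') + (z * y + aeval u G * z') := by
        rw [map_mul]
        linear_combination (- y) * hjz - aeval u G * hjz'
      rw [key]
      refine Submodule.add_mem_sup (Ideal.add_mem _ (Ideal.mul_mem_right _ _ hj)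
        (Ideal.mul_mem_left _ _ hj')) (Ideal.add_mem _ ?_ ?_)
      · rw [show n + 1 + 1 = 2 + n by ring, pow_add]
        exact Ideal.mul_mem_mul hz hy
      · rw [pow_succ' _ (n + 1)]
        exact Ideal.mul_mem_mul hGm hz'
    · obtain ⟨G, hG, hxG⟩ := hx
      obtain ⟨H, hH, hyH⟩ := hy
      refine ⟨G + H, hG.add hH, ?_⟩
      rw [map_add, add_sub_add_comm]
      exact Ideal.add_mem _ hxG hyH

end Expansion

/-- Krull's intersection theorem: a polynomial in `⋂ n, J + 𝔪ₐ ^ n` belongs to `J` locally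
at `a`. -/
theorem exists_mul_mem_of_forall_mem_sup {N : ℕ} {a : Fin N → ℝ}
    {J : Ideal (MvPolynomial (Fin N) ℝ)} {g : MvPolynomial (Fin N) ℝ}
    (hg : ∀ n, g ∈ J ⊔ maxIdealAt a ^ (n + 1)) : ∃ s, eval a s ≠ 0 ∧ s * g ∈ J := by
  have h1 : (Submodule.Quotient.mk g : MvPolynomial (Fin N) ℝ ⧸ J) ∈
      (⨅ i : ℕ, maxIdealAt a ^ i • ⊤ : Submodule (MvPolynomial (Fin N) ℝ) _) := by
    rw [Submodule.mem_iInf]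
    intro i
    have h2 : g ∈ J ⊔ maxIdealAt a ^ i :=
      (sup_le_sup_left (Ideal.pow_le_pow_right (Nat.le_succ i)) J) (hg i)
    obtain ⟨j, hj, z, hz, rfl⟩ := Submodule.mem_sup.1 h2
    have h3 : (Submodule.Quotient.mk (j + z) : MvPolynomial (Fin N) ℝ ⧸ J) =
        z • Submodule.Quotient.mk 1 := by
      rw [← Submodule.Quotient.mk_smul, Submodule.Quotient.eq]
      simpa using hj
    rw [h3]
    exact Submodule.smul_mem_smul hz trivial
  obtain ⟨⟨r, hr⟩, hrg⟩ := (Ideal.mem_iInf_smul_pow_eq_bot_iff _ _).1 h1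
  refine ⟨1 - r, ?_, ?_⟩
  · rw [map_sub, mem_maxIdealAt.1 hr]
    simp
  · rw [← Submodule.Quotient.mk_smul, Submodule.Quotient.eq] at hrg
    have := J.neg_mem hrg
    convert this using 1
    simp only [smul_eq_mul]
    ring

/-! ### Parameters at a regular point -/

theorem exists_finset_span_eq_maximalIdeal {O : Type*} [CommRing O] [IsRegularLocalRing O] {d : ℕ}
    (hdim : ringKrullDim O = d) :
    ∃ s : Finset O, s.card = d ∧ Ideal.span (s : Set O) = IsLocalRing.maximalIdeal O := by
  have hfg : Submodule.FG (IsLocalRing.maximalIdeal O) := IsNoetherian.noetherian _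
  obtain ⟨s, hs, hsm⟩ := hfg.exists_span_finset_card_eq_spanFinrank
  refine ⟨s, ?_, hsm⟩
  have := ‹IsRegularLocalRing O›.spanFinrank_maximalIdeal
  rw [hdim] at this
  rw [hs]
  exact_mod_cast this

/-- A form of Nakayama's lemma. -/
theorem maximalIdeal_le_of_le_sup_sq {O : Type*} [CommRing O] [IsLocalRing O] [IsNoetherianRing O]
    {J : Ideal O} (h : IsLocalRing.maximalIdeal O ≤ J ⊔ IsLocalRing.maximalIdeal O ^ 2) :
    IsLocalRing.maximalIdeal O ≤ J := by
  refine Submodule.le_of_le_smul_of_le_jacobson_bot (I := IsLocalRing.maximalIdeal O)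
    (IsNoetherian.noetherian _) (IsLocalRing.jacobson_eq_maximalIdeal _ bot_ne_top).ge ?_
  rwa [smul_eq_mul, ← pow_two]

theorem le_of_span_range_eq_maximalIdeal {O : Type*} [CommRing O] [IsLocalRing O]
    [IsNoetherianRing O] {d d' : ℕ} (hdim : ringKrullDim O = d) {u : Fin d' → O}
    (hu : Ideal.span (Set.range u) = IsLocalRing.maximalIdeal O) : d ≤ d' := by
  have h1 := Ideal.height_le_spanFinrank (IsLocalRing.maximalIdeal O)
    (Ideal.IsPrime.ne_top inferInstance)
  have h2 : (IsLocalRing.maximalIdeal O).spanFinrank ≤ d' := by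
    rw [← hu]
    refine (Submodule.spanFinrank_span_le_ncard_of_finite (Set.finite_range _)).trans ?_
    rw [← Set.image_univ]
    refine (Set.ncard_image_le Set.finite_univ).trans ?_
    simp [Set.ncard_univ]
  have h3 := IsLocalRing.maximalIdeal_height_eq_ringKrullDim (R := O)
  rw [hdim] at h3
  have h4 : (IsLocalRing.maximalIdeal O).height = d := by exact_mod_cast h3
  rw [h4] at h1
  exact (by exact_mod_cast h1 : d ≤ _).trans h2

section Germ

variable {N : ℕ} (X : Set (Fin N → ℝ)) (a : X)

/-- The homomorphism sending a polynomial to its germ at `a` on `X`. -/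
def germ : MvPolynomial (Fin N) ℝ →ₐ[ℝ] LocalRingAt X a :=
  (IsScalarTower.toAlgHom ℝ (CoordRing X) (LocalRingAt X a)).comp
    (Ideal.Quotient.mkₐ ℝ (vanishingIdeal ℝ X))

theorem germ_apply (p : MvPolynomial (Fin N) ℝ) :
    germ X a p = algebraMap (CoordRing X) (LocalRingAt X a) (Ideal.Quotient.mk _ p) := rfl

theorem mk_mem_pointIdeal {p : MvPolynomial (Fin N) ℝ} :
    Ideal.Quotient.mk (vanishingIdeal ℝ X) p ∈ pointIdeal X a ↔ eval (a : Fin N → ℝ) p = 0 :=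
  Iff.rfl

theorem germ_mem_maximalIdeal {p : MvPolynomial (Fin N) ℝ} :
    germ X a p ∈ IsLocalRing.maximalIdeal (LocalRingAt X a) ↔ eval (a : Fin N → ℝ) p = 0 := by
  rw [germ_apply, IsLocalization.AtPrime.to_map_mem_maximal_iff _ (pointIdeal X a),
    mk_mem_pointIdeal]

theorem germ_eq_zero {p : MvPolynomial (Fin N) ℝ} (hp : p ∈ vanishingIdeal ℝ X) :
    germ X a p = 0 := by
  rw [germ_apply, Ideal.Quotient.eq_zero_iff_mem.2 hp, map_zero]

theorem map_germ_maxIdealAt :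
    (maxIdealAt (a : Fin N → ℝ)).map (germ X a) =
      IsLocalRing.maximalIdeal (LocalRingAt X a) := by
  refine le_antisymm ?_ ?_
  · rw [Ideal.map_le_iff_le_comap]
    exact fun p hp => (germ_mem_maximalIdeal X a).2 hp
  · rw [← Localization.AtPrime.map_eq_maximalIdeal, Ideal.map_le_iff_le_comap]
    intro y hy
    obtain ⟨p, rfl⟩ := Ideal.Quotient.mk_surjective y
    exact Ideal.mem_map_of_mem (germ X a) ((mk_mem_pointIdeal X a).1 hy)

theorem exists_mul_mem_of_germ_mem {K : Ideal (MvPolynomial (Fin N) ℝ)}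
    {p : MvPolynomial (Fin N) ℝ} (hp : germ X a p ∈ K.map (germ X a)) :
    ∃ s, eval (a : Fin N → ℝ) s ≠ 0 ∧ s * p ∈ K ⊔ vanishingIdeal ℝ X := by
  have h1 : K.map (germ X a) = (K.map (Ideal.Quotient.mk (vanishingIdeal ℝ X))).map
      (algebraMap (CoordRing X) (LocalRingAt X a)) := by
    rw [Ideal.map_map]; rfl
  rw [h1, germ_apply, IsLocalization.algebraMap_mem_map_algebraMap_iff
    (pointIdeal X a).primeCompl] at hp
  obtain ⟨s, hs, hsp⟩ := hp
  obtain ⟨s, rfl⟩ := Ideal.Quotient.mk_surjective s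
  refine ⟨s, fun h0 => hs ((mk_mem_pointIdeal X a).2 h0), ?_⟩
  rw [← map_mul] at hsp
  have h2 : s * p ∈ (K.map (Ideal.Quotient.mk (vanishingIdeal ℝ X))).comap
    (Ideal.Quotient.mk (vanishingIdeal ℝ X)) := hsp
  rwa [Ideal.comap_map_of_surjective _ Ideal.Quotient.mk_surjective, ← RingHom.ker_eq_comap_bot,
    Ideal.mk_ker] at h2

theorem exists_germ_eq_mul_unit (y : LocalRingAt X a) :
    ∃ (p : MvPolynomial (Fin N) ℝ) (v : LocalRingAt X a), IsUnit v ∧ y * v = germ X a p := by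
  obtain ⟨p, s, rfl⟩ := IsLocalization.exists_mk'_eq (pointIdeal X a).primeCompl y
  obtain ⟨p, rfl⟩ := Ideal.Quotient.mk_surjective p
  exact ⟨p, _, IsLocalization.map_units _ s, IsLocalization.mk'_spec _ _ _⟩

/-- The Zariski tangent space at a regular point has dimension at most `d`: after multiplication by
units, `d` generators of the maximal ideal are germs of polynomials, and their gradients span `ℝ^N`
modulo the gradients of the polynomials vanishing on `X`. -/
theorem finrank_le_of_isRegularLocalRing {d : ℕ} [IsRegularLocalRing (LocalRingAt X a)]
    (hdim : ringKrullDim (LocalRingAt X a) = d) :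
    N ≤ d + Module.finrank ℝ (Submodule.map (grad (a : Fin N → ℝ))
      ((vanishingIdeal ℝ X).restrictScalars ℝ)) := by
  classical
  set W := Submodule.map (grad (a : Fin N → ℝ)) ((vanishingIdeal ℝ X).restrictScalars ℝ) with hW
  set m := IsLocalRing.maximalIdeal (LocalRingAt X a)
  obtain ⟨s, hcard, hsm⟩ := exists_finset_span_eq_maximalIdeal
    (O := LocalRingAt X a) hdim
  choose p v hv hpv using exists_germ_eq_mul_unit X a
  set T : Finset (MvPolynomial (Fin N) ℝ) := s.image p
  have hT0 : ∀ q ∈ T, eval (a : Fin N → ℝ) q = 0 := by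
    intro q hq
    obtain ⟨y, hy, rfl⟩ := Finset.mem_image.1 hq
    rw [← germ_mem_maximalIdeal, ← hpv]
    refine Ideal.mul_mem_right _ _ ?_
    have : y ∈ Ideal.span (s : Set (LocalRingAt X a)) := Ideal.subset_span hy
    rwa [hsm] at this
  have hle : m ≤ (Ideal.span (T : Set (MvPolynomial (Fin N) ℝ))).map (germ X a) := by
    rw [show m = _ from hsm.symm, Ideal.span_le]
    intro y hy
    refine (Ideal.mul_unit_mem_iff_mem _ (hv y)).1 ?_
    rw [hpv]
    exact Ideal.mem_map_of_mem _
      (Ideal.subset_span (Finset.mem_coe.2 (Finset.mem_image_of_mem p hy)))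
  set V := Submodule.span ℝ ((T.image (grad (a : Fin N → ℝ)) : Finset _) : Set (Fin N → ℝ))
  have hgradI : ∀ q ∈ Ideal.span (T : Set (MvPolynomial (Fin N) ℝ)) ⊔ vanishingIdeal ℝ X,
      grad (a : Fin N → ℝ) q ∈ V ⊔ W := by
    intro q hq
    obtain ⟨q₁, h₁, q₂, h₂, rfl⟩ := Submodule.mem_sup.1 hq
    rw [map_add]
    refine Submodule.add_mem_sup ?_ (Submodule.mem_map_of_mem h₂)
    refine Submodule.span_induction (p := fun q _ => grad (a : Fin N → ℝ) q ∈ V)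
      (fun q hq => ?_) ?_ (fun x y _ _ hx hy => ?_) (fun c x hx hxV => ?_) h₁
    · exact Submodule.subset_span (Finset.mem_coe.2 (Finset.mem_image_of_mem _ hq))
    · simp
    · rw [map_add]; exact Submodule.add_mem _ hx hy
    · have : eval (a : Fin N → ℝ) x = 0 := by
        have : Ideal.span (T : Set (MvPolynomial (Fin N) ℝ)) ≤ maxIdealAt (a : Fin N → ℝ) :=
          Ideal.span_le.2 fun q hq => hT0 q hq
        exact this hx
      rw [smul_eq_mul, grad_mul, this, zero_smul, add_zero]
      exact Submodule.smul_mem _ _ hxV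
  have htop : V ⊔ W = ⊤ := by
    rw [eq_top_iff]
    intro w _
    have h1 : germ X a (linearForm (a : Fin N → ℝ) w) ∈
        (Ideal.span (T : Set (MvPolynomial (Fin N) ℝ))).map (germ X a) :=
      hle ((germ_mem_maximalIdeal X a).2 (linearForm_mem _ w))
    obtain ⟨c, hc, hcw⟩ := exists_mul_mem_of_germ_mem X a h1
    have h2 := hgradI _ hcw
    rw [grad_mul, grad_linearForm, mem_maxIdealAt.1 (linearForm_mem _ w), zero_smul,
      add_zero] at h2
    exact (Submodule.smul_mem_iff _ hc).1 h2
  have h3 := Submodule.finrank_add_le_finrank_add_finrank V W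
  rw [htop, finrank_top, Module.finrank_fin_fun] at h3
  have h4 : Module.finrank ℝ V ≤ d := by
    refine (finrank_span_finset_le_card _).trans ?_
    exact Finset.card_image_le.trans (Finset.card_image_le.trans hcard.le)
  omega

/-- Around a regular point `a` of `X` there are `d` linear forms `u` generating the maximal ideal
of `𝓞_{X,a}` and finitely many polynomials `h` vanishing on `X`, such that the gradients of
all of these form a basis of `ℝ^N`. -/
theorem exists_parameters {d : ℕ} [IsRegularLocalRing (LocalRingAt X a)]
    (hdim : ringKrullDim (LocalRingAt X a) = d) :
    ∃ (e : ℕ) (u : Fin d → MvPolynomial (Fin N) ℝ) (h : Fin e → MvPolynomial (Fin N) ℝ)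
      (B : Module.Basis (Fin d ⊕ Fin e) ℝ (Fin N → ℝ)),
      (∀ i, u i ∈ maxIdealAt (a : Fin N → ℝ)) ∧ (∀ j, h j ∈ vanishingIdeal ℝ X) ∧
      (∀ i, grad (a : Fin N → ℝ) (u i) = B (Sum.inl i)) ∧
      (∀ j, grad (a : Fin N → ℝ) (h j) = B (Sum.inr j)) ∧
      Ideal.span (Set.range fun i => germ X a (u i)) =
        IsLocalRing.maximalIdeal (LocalRingAt X a) := by
  set W := Submodule.map (grad (a : Fin N → ℝ)) ((vanishingIdeal ℝ X).restrictScalars ℝ) with hW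
  obtain ⟨W', hW'⟩ := Submodule.exists_isCompl W
  have hN := finrank_le_of_isRegularLocalRing X a hdim
  rw [← hW] at hN
  have hN' := Submodule.finrank_add_eq_of_isCompl hW'.symm
  rw [Module.finrank_fin_fun] at hN'
  set d' := Module.finrank ℝ W' with hd'
  set e := Module.finrank ℝ W
  let B : Module.Basis (Fin d' ⊕ Fin e) ℝ (Fin N → ℝ) :=
    ((Module.finBasis ℝ W').prod (Module.finBasis ℝ W)).map
      (Submodule.prodEquivOfIsCompl W' W hW'.symm)
  have hBr : ∀ j, B (Sum.inr j) ∈ W := fun j => by simp [B]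
  have hh : ∀ j, ∃ q ∈ vanishingIdeal ℝ X, grad (a : Fin N → ℝ) q = B (Sum.inr j) :=
    fun j => (Submodule.mem_map).1 (hBr j)
  choose h hhI hhB using hh
  let u : Fin d' → MvPolynomial (Fin N) ℝ := fun i => linearForm a (B (Sum.inl i))
  have hum : ∀ i, u i ∈ maxIdealAt (a : Fin N → ℝ) := fun i => linearForm_mem _ _
  have hIm : vanishingIdeal ℝ X ≤ maxIdealAt (a : Fin N → ℝ) := fun q hq => by
    have := hq (a : Fin N → ℝ) a.2
    rwa [aeval_eq_eval] at this
  have huB : ∀ i, grad (a : Fin N → ℝ) (u i) = B (Sum.inl i) := fun i => grad_linearForm _ _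
  have hspan : ⊤ ≤ Submodule.span ℝ (Set.range (Sum.elim
      (fun i => grad (a : Fin N → ℝ) (u i)) fun j => grad (a : Fin N → ℝ) (h j))) := by
    have : Sum.elim (fun i => grad (a : Fin N → ℝ) (u i)) (fun j => grad (a : Fin N → ℝ) (h j))
        = B := by
      ext1 (i | j)
      · exact huB i
      · exact hhB j
    rw [this, B.span_eq]
  have hgen : Ideal.span (Set.range fun i => germ X a (u i)) =
      IsLocalRing.maximalIdeal (LocalRingAt X a) := by
    set m := IsLocalRing.maximalIdeal (LocalRingAt X a) with hm
    refine le_antisymm ?_ ?_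
    · rw [Ideal.span_le]
      rintro _ ⟨i, rfl⟩
      exact (germ_mem_maximalIdeal X a).2 (hum i)
    · refine maximalIdeal_le_of_le_sup_sq (O := LocalRingAt X a) ?_
      conv_lhs => rw [← map_germ_maxIdealAt]
      rw [Ideal.map_le_iff_le_comap]
      intro q hq
      obtain ⟨G, hG, hqG⟩ := exists_linear_sub_mem hum (fun j => hIm (hhI j)) hspan hq
      obtain ⟨j, hj, z, hz, hjz⟩ := Submodule.mem_sup.1 hqG
      have h1 : germ X a q = aeval (fun i => germ X a (u i)) G + germ X a z := by
        have h2 : germ X a j = 0 := germ_eq_zero X a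
          ((Ideal.span_le.2 (by rintro _ ⟨i, rfl⟩; exact hhI i) :
            Ideal.span (Set.range h) ≤ vanishingIdeal ℝ X) hj)
        have h3 : q = j + z + aeval u G := by rw [hjz]; ring
        rw [h3, map_add, map_add, h2, zero_add, add_comm, ← AlgHom.comp_apply, comp_aeval]
      rw [Ideal.mem_comap, h1]
      refine Submodule.add_mem_sup ?_ ?_
      · simpa using aeval_mem_pow_of_isHomogeneous (I := Ideal.span
          (Set.range fun i => germ X a (u i))) (fun i => Ideal.subset_span ⟨i, rfl⟩) hG
      · rw [← map_germ_maxIdealAt, ← Ideal.map_pow]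
        exact Ideal.mem_map_of_mem _ hz
  have hdd' : d = d' := le_antisymm
    (le_of_span_range_eq_maximalIdeal (O := LocalRingAt X a) hdim hgen) (by omega)
  clear_value B d'
  subst hdd'
  exact ⟨e, u, h, B, hum, hhI, huB, hhB, hgen⟩

end Germ

/-- The condition on `q` in the definition of a rational function: the set `{q ≠ 0}` is Zariski
dense in `X`. -/
def DenseNonvanishing {N : ℕ} (X : Set (Fin N → ℝ)) (q : MvPolynomial (Fin N) ℝ) : Prop :=
  ∀ r : MvPolynomial (Fin N) ℝ,
    (∀ x ∈ X, eval x q ≠ 0 → eval x r = 0) → ∀ x ∈ X, eval x r = 0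

theorem mem_vanishingIdeal_iff_eval {N : ℕ} {X : Set (Fin N → ℝ)}
    {p : MvPolynomial (Fin N) ℝ} : p ∈ vanishingIdeal ℝ X ↔ ∀ x ∈ X, eval x p = 0 := by
  simp [mem_vanishingIdeal_iff, aeval_eq_eval]

section Parameters

variable {N d e : ℕ} {X : Set (Fin N → ℝ)} {a : X} {u : Fin d → MvPolynomial (Fin N) ℝ}
  {h : Fin e → MvPolynomial (Fin N) ℝ}

theorem span_le_vanishingIdeal (hh : ∀ j, h j ∈ vanishingIdeal ℝ X) :
    Ideal.span (Set.range h) ≤ vanishingIdeal ℝ X :=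
  Ideal.span_le.2 (by rintro _ ⟨j, rfl⟩; exact hh j)

/-- Near a regular point, the equations `h` define the ideal of `X`. -/
theorem exists_mul_mem_span_of_mem_vanishingIdeal [IsRegularLocalRing (LocalRingAt X a)]
    (hdim : ringKrullDim (LocalRingAt X a) = d)
    (hu : ∀ i, u i ∈ maxIdealAt (a : Fin N → ℝ)) (hh : ∀ j, h j ∈ vanishingIdeal ℝ X)
    (hspan : ⊤ ≤ Submodule.span ℝ (Set.range (Sum.elim
      (fun i => grad (a : Fin N → ℝ) (u i)) fun j => grad (a : Fin N → ℝ) (h j))))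
    (hgen : Ideal.span (Set.range fun i => germ X a (u i)) =
        IsLocalRing.maximalIdeal (LocalRingAt X a))
    {g : MvPolynomial (Fin N) ℝ} (hg : g ∈ vanishingIdeal ℝ X) :
    ∃ s, eval (a : Fin N → ℝ) s ≠ 0 ∧ s * g ∈ Ideal.span (Set.range h) := by
  refine exists_mul_mem_of_forall_mem_sup fun n => ?_
  have hhm : ∀ j, h j ∈ maxIdealAt (a : Fin N → ℝ) := fun j =>
    mem_vanishingIdeal_iff_eval.1 (hh j) a a.2
  induction n with
  | zero =>
    refine Ideal.mem_sup_right ?_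
    rw [zero_add, pow_one]
    exact mem_vanishingIdeal_iff_eval.1 hg a a.2
  | succ n ih =>
    obtain ⟨j, hj, z, hz, hjz⟩ := Submodule.mem_sup.1 ih
    obtain ⟨G, hG, hzG⟩ := exists_homogeneous_sub_mem hu hhm hspan (n + 1) hz
    have hgermz : germ X a z = 0 := by
      have : z = g - j := by rw [← hjz]; ring
      rw [this]
      exact germ_eq_zero X a (Ideal.sub_mem _ hg (span_le_vanishingIdeal hh hj))
    obtain ⟨j', hj', z', hz', hjz'⟩ := Submodule.mem_sup.1 hzG
    have hG0 : G = 0 := by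
      refine eq_zero_of_aeval_mem_of_isHomogeneous (O := LocalRingAt X a) hgen hdim.ge hG ?_
      have h1 : aeval (fun i => germ X a (u i)) G = - germ X a z' := by
        have h2 : germ X a j' = 0 := germ_eq_zero X a (span_le_vanishingIdeal hh hj')
        have h3 : aeval u G = z - j' - z' := by linear_combination hjz'
        have h4 : aeval (fun i => germ X a (u i)) G = germ X a (aeval u G) := by
          rw [← AlgHom.comp_apply, comp_aeval]
        rw [h4, h3, map_sub, map_sub, h2, hgermz]
        ring
      rw [h1, ← map_germ_maxIdealAt, ← Ideal.map_pow]
      exact neg_mem (Ideal.mem_map_of_mem _ hz')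
    rw [hG0, map_zero, sub_zero] at hzG
    rw [← hjz]
    exact Ideal.add_mem _ (Ideal.mem_sup_left hj) hzG

/-- A polynomial which is not a zero divisor on `X` has a nonzero leading form in the
parameters `u`. -/
theorem exists_leadingForm (hu : ∀ i, u i ∈ maxIdealAt (a : Fin N → ℝ))
    (hh : ∀ j, h j ∈ vanishingIdeal ℝ X)
    (hspan : ⊤ ≤ Submodule.span ℝ (Set.range (Sum.elim
      (fun i => grad (a : Fin N → ℝ) (u i)) fun j => grad (a : Fin N → ℝ) (h j))))
    {q : MvPolynomial (Fin N) ℝ} (hq : DenseNonvanishing X q) :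
    ∃ (n : ℕ) (G : MvPolynomial (Fin d) ℝ), G.IsHomogeneous n ∧ G ≠ 0 ∧
      q - aeval u G ∈ Ideal.span (Set.range h) ⊔ maxIdealAt (a : Fin N → ℝ) ^ (n + 1) := by
  classical
  have hhm : ∀ j, h j ∈ maxIdealAt (a : Fin N → ℝ) := fun j =>
    mem_vanishingIdeal_iff_eval.1 (hh j) a a.2
  have hex : ∃ n, q ∉ Ideal.span (Set.range h) ⊔ maxIdealAt (a : Fin N → ℝ) ^ (n + 1) := by
    by_contra! hcon
    obtain ⟨s, hs, hsq⟩ := exists_mul_mem_of_forall_mem_sup hcon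
    refine hs (hq s (fun x hx hqx => ?_) a a.2)
    have := mem_vanishingIdeal_iff_eval.1 (span_le_vanishingIdeal hh hsq) x hx
    rw [map_mul] at this
    exact (mul_eq_zero.1 this).resolve_right hqx
  set n := Nat.find hex
  have hn := Nat.find_spec hex
  have hn' : q ∈ Ideal.span (Set.range h) ⊔ maxIdealAt (a : Fin N → ℝ) ^ n := by
    rcases Nat.eq_zero_or_pos n with h0 | h0
    · rw [h0]; simp
    · have := Nat.find_min hex (m := n - 1) (by omega)
      rw [not_not, Nat.sub_add_cancel h0] at this
      exact this
  obtain ⟨j, hj, z, hz, hjz⟩ := Submodule.mem_sup.1 hn'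
  obtain ⟨G, hG, hzG⟩ := exists_homogeneous_sub_mem hu hhm hspan n hz
  have hqG : q - aeval u G ∈
      Ideal.span (Set.range h) ⊔ maxIdealAt (a : Fin N → ℝ) ^ (n + 1) := by
    have : q - aeval u G = j + (z - aeval u G) := by rw [← hjz]; ring
    rw [this]
    exact Ideal.add_mem _ (Ideal.mem_sup_left hj) hzG
  refine ⟨n, G, hG, fun h0 => hn ?_, hqG⟩
  rwa [h0, map_zero, sub_zero] at hqG

end Parameters

/-! ### Analytic charts at a regular point -/

theorem hasFDerivAt_eval {N : ℕ} (a : Fin N → ℝ) (p : MvPolynomial (Fin N) ℝ) :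
    HasFDerivAt (fun x => eval x p)
      (∑ k, grad a p k • (ContinuousLinearMap.proj k : (Fin N → ℝ) →L[ℝ] ℝ)) a := by
  induction p using MvPolynomial.induction_on with
  | C c => simpa [grad_C] using hasFDerivAt_const c a
  | add p q hp hq =>
    simp only [map_add, Pi.add_apply, add_smul, Finset.sum_add_distrib]
    exact hp.fun_add hq
  | mul_X p i hp =>
    have h1 : HasFDerivAt (fun x : Fin N → ℝ => x i)
        (ContinuousLinearMap.proj i : (Fin N → ℝ) →L[ℝ] ℝ) a :=
      (ContinuousLinearMap.proj i : (Fin N → ℝ) →L[ℝ] ℝ).hasFDerivAt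
    simp only [map_mul, eval_X]
    refine (hp.fun_mul h1).congr_fderiv ?_
    rw [Finset.smul_sum, add_comm, grad_mul, grad_X, eval_X]
    simp only [Pi.add_apply, Pi.smul_apply, add_smul, Finset.sum_add_distrib, smul_eq_mul,
      mul_smul]
    rw [add_comm]
    congr 1
    rw [← Finset.smul_sum, Finset.sum_eq_single i]
    · simp
    · intro k _ hk
      simp [hk]
    · simp

theorem analyticAt_eval {N : ℕ} (a : Fin N → ℝ) (p : MvPolynomial (Fin N) ℝ) :
    AnalyticAt ℝ (fun x => eval x p) a :=
  AnalyticOnNhd.eval_mvPolynomial p a trivial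

theorem isBigO_eval {N : ℕ} {a : Fin N → ℝ} {n : ℕ} {z : MvPolynomial (Fin N) ℝ}
    (hz : z ∈ maxIdealAt a ^ n) : (fun x => eval x z) =O[𝓝 a] fun x => ‖x - a‖ ^ n := by
  induction n generalizing z with
  | zero =>
    simp only [pow_zero]
    exact (analyticAt_eval a z).continuousAt.isBigO_one ℝ
  | succ n ih =>
    rw [pow_succ'] at hz
    refine Submodule.mul_induction_on hz (fun x hx y hy => ?_) fun x y hx hy => ?_
    · have h1 : (fun w => eval w x) =O[𝓝 a] fun w => ‖w - a‖ := by
        have := (hasFDerivAt_eval a x).differentiableAt.isBigO_sub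
        simpa [mem_maxIdealAt.1 hx] using this.norm_right
      simpa [pow_succ'] using h1.mul (ih hy)
    · simpa using hx.add hy

theorem isBigO_eval_comp {N : ℕ} {γ : ℝ → Fin N → ℝ} (hγ : DifferentiableAt ℝ γ 0) {n : ℕ}
    {z : MvPolynomial (Fin N) ℝ} (hz : z ∈ maxIdealAt (γ 0) ^ n) :
    (fun t => eval (γ t) z) =O[𝓝 0] fun t => t ^ n := by
  have h1 : (fun t => ‖γ t - γ 0‖) =O[𝓝 0] fun t => t := by
    simpa using hγ.isBigO_sub.norm_left
  exact ((isBigO_eval hz).comp_tendsto hγ.continuousAt).trans (h1.pow n)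

/-- At a regular point `a`, the set `X` contains the image of an analytic germ `φ` inverse to a
system of parameters `u`, and a polynomial with Zariski dense nonvanishing set does not vanish along
the image of almost any line through the origin. -/
theorem exists_chart {N d : ℕ} {X : Set (Fin N → ℝ)} (hX : IsAlgebraicSet X) (a : X)
    [IsRegularLocalRing (LocalRingAt X a)] (hdim : ringKrullDim (LocalRingAt X a) = d) :
    ∃ φ : (Fin d → ℝ) → X, φ 0 = a ∧ AnalyticAt ℝ (fun w => (φ w : Fin N → ℝ)) 0 ∧
      (∃ u : Fin d → MvPolynomial (Fin N) ℝ, (∀ i, u i ∈ maxIdealAt (a : Fin N → ℝ)) ∧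
        ∀ᶠ w in 𝓝 0, ∀ i, eval (φ w : Fin N → ℝ) (u i) = w i) ∧
      ∀ q, DenseNonvanishing X q → ∃ Q : MvPolynomial (Fin d) ℝ, Q ≠ 0 ∧
        ∀ v, eval v Q ≠ 0 → ∀ᶠ t in 𝓝[≠] (0 : ℝ), eval (φ (t • v) : Fin N → ℝ) q ≠ 0 := by
  classical
  obtain ⟨e, u, h, B, hu, hh, huB, hhB, hgen⟩ := exists_parameters X a hdim
  have hB : Sum.elim (fun i => grad (a : Fin N → ℝ) (u i)) (fun j => grad (a : Fin N → ℝ) (h j))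
      = B := by
    ext1 (i | j)
    · exact huB i
    · exact hhB j
  have hspan : ⊤ ≤ Submodule.span ℝ (Set.range (Sum.elim
      (fun i => grad (a : Fin N → ℝ) (u i)) fun j => grad (a : Fin N → ℝ) (h j))) := by
    rw [hB, B.span_eq]
  let ψ : (Fin N → ℝ) → (Fin d ⊕ Fin e → ℝ) := fun x s => eval x (Sum.elim u h s)
  have hgrad : ∀ s, grad (a : Fin N → ℝ) (Sum.elim u h s) = B s := by
    rintro (i | j)
    · exact huB i
    · exact hhB j
  have hψa : ψ a = 0 := by
    ext (i | j)
    · exact hu i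
    · exact mem_vanishingIdeal_iff_eval.1 (hh j) a a.2
  have hψan : ContDiffAt ℝ ⊤ ψ a := by
    rw [contDiffAt_pi]
    exact fun s => (analyticAt_eval _ _).contDiffAt
  let ℓ : (Fin N → ℝ) →ₗ[ℝ] (Fin d ⊕ Fin e → ℝ) :=
    LinearMap.pi fun s => ∑ k, B s k • (LinearMap.proj k)
  have hℓ : ∀ v s, ℓ v s = ∑ k, B s k * v k := fun v s => by simp [ℓ]
  have hinj : Function.Injective ℓ := by
    rw [injective_iff_map_eq_zero]
    intro v hv
    have h1 : ∀ w : Fin N → ℝ, ∑ k, w k * v k = 0 := by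
      intro w
      have hw : w ∈ Submodule.span ℝ (Set.range B) := by rw [B.span_eq]; trivial
      refine Submodule.span_induction (p := fun w _ => ∑ k, w k * v k = 0) ?_ ?_ ?_ ?_ hw
      · rintro _ ⟨s, rfl⟩
        rw [← hℓ, hv]; rfl
      · simp
      · intro x y _ _ hx hy
        simp [add_mul, Finset.sum_add_distrib, hx, hy]
      · intro c x _ hx
        simp [mul_assoc, ← Finset.mul_sum, hx]
    have h2 := h1 v
    rw [Finset.sum_eq_zero_iff_of_nonneg fun k _ => mul_self_nonneg _] at h2
    ext k
    exact mul_self_eq_zero.1 (h2 k (Finset.mem_univ k))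
  have hcard : Module.finrank ℝ (Fin N → ℝ) = Module.finrank ℝ (Fin d ⊕ Fin e → ℝ) := by
    rw [Module.finrank_eq_card_basis B, Module.finrank_fintype_fun_eq_card]
  let L : (Fin N → ℝ) ≃L[ℝ] (Fin d ⊕ Fin e → ℝ) :=
    (LinearEquiv.ofInjectiveOfFinrankEq ℓ hinj hcard).toContinuousLinearEquiv
  have hL : HasFDerivAt ψ (L : (Fin N → ℝ) →L[ℝ] (Fin d ⊕ Fin e → ℝ)) a := by
    rw [hasFDerivAt_pi']
    intro s
    have h1 := hasFDerivAt_eval (a : Fin N → ℝ) (Sum.elim u h s)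
    refine h1.congr_fderiv ?_
    rw [hgrad]
    ext1 v
    have hLs : L v s = ∑ k, B s k * v k := hℓ v s
    simpa using hLs.symm
  have htop : (⊤ : WithTop ℕ∞) ≠ 0 := by simp
  let χ := hψan.localInverse hL htop
  have hχan : AnalyticAt ℝ χ (ψ a) :=
    (hψan.to_localInverse hL htop).analyticAt
  have hχa : χ (ψ a) = a := hψan.localInverse_apply_image hL htop
  have hχr : ∀ᶠ y in 𝓝 (ψ a), ψ (χ y) = y :=
    (hψan.hasStrictFDerivAt' hL htop).eventually_right_inverse
  rw [hψa] at hχan hχa hχr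
  let ι : (Fin d → ℝ) →L[ℝ] (Fin d ⊕ Fin e → ℝ) :=
    ContinuousLinearMap.pi (Sum.elim (fun i => ContinuousLinearMap.proj i) fun _ => 0)
  have hιl : ∀ w i, ι w (Sum.inl i) = w i := fun w i => rfl
  have hιr : ∀ w j, ι w (Sum.inr j) = 0 := fun w j => rfl
  let φ₀ : (Fin d → ℝ) → Fin N → ℝ := fun w => χ (ι w)
  have hφ₀an : AnalyticAt ℝ φ₀ 0 := by
    refine AnalyticAt.comp (g := χ) ?_ (ι.analyticAt 0)
    rwa [map_zero]
  have hφ₀0 : φ₀ 0 = a := by simp only [φ₀, map_zero]; exact hχa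
  have hφ₀r : ∀ᶠ w in 𝓝 0, ψ (φ₀ w) = ι w := by
    have : Filter.Tendsto ι (𝓝 0) (𝓝 0) := by
      simpa using ι.continuous.tendsto 0
    exact this.eventually hχr
  have hφ₀u : ∀ᶠ w in 𝓝 0, ∀ i, eval (φ₀ w) (u i) = w i := by
    filter_upwards [hφ₀r] with w hw i
    exact congrFun hw (Sum.inl i)
  have hφ₀h : ∀ᶠ w in 𝓝 0, ∀ p ∈ Ideal.span (Set.range h), eval (φ₀ w) p = 0 := by
    filter_upwards [hφ₀r] with w hw p hp
    have : Ideal.span (Set.range h) ≤ RingHom.ker (eval (φ₀ w)) := by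
      rw [Ideal.span_le]
      rintro _ ⟨j, rfl⟩
      exact congrFun hw (Sum.inr j)
    exact this hp
  have hφ₀X : ∀ᶠ w in 𝓝 0, φ₀ w ∈ X := by
    obtain ⟨T, hT⟩ : (vanishingIdeal ℝ X).FG := IsNoetherian.noetherian _
    have h1 : ∀ g ∈ T, ∀ᶠ w in 𝓝 0, eval (φ₀ w) g = 0 := by
      intro g hg
      obtain ⟨s, hs, hsg⟩ := exists_mul_mem_span_of_mem_vanishingIdeal hdim hu hh hspan hgen
        (g := g) (by rw [← hT]; exact Ideal.subset_span hg)
      have hcont : ContinuousAt (fun w => eval (φ₀ w) s) 0 :=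
        (s.continuous_eval.continuousAt).comp hφ₀an.continuousAt
      have hne := hcont.eventually_ne (by rw [hφ₀0]; exact hs)
      filter_upwards [hne, hφ₀h] with w h2 h3
      have := h3 _ hsg
      rw [map_mul] at this
      exact (mul_eq_zero.1 this).resolve_left h2
    rw [← Filter.eventually_all_finset] at h1
    filter_upwards [h1] with w hw
    obtain ⟨S, hS⟩ := hX
    rw [hS]
    intro p hp
    have h2 : vanishingIdeal ℝ X ≤ RingHom.ker (eval (φ₀ w)) := by
      rw [← hT, Ideal.span_le]
      exact fun g hg => hw g hg
    refine h2 (mem_vanishingIdeal_iff_eval.2 fun x hx => ?_)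
    rw [hS] at hx
    exact hx p hp
  -- away from the origin `φ₀` may leave `X`; its values there are replaced by `a`
  let φ : (Fin d → ℝ) → X := fun w => if hw : φ₀ w ∈ X then ⟨φ₀ w, hw⟩ else a
  have hφ : ∀ᶠ w in 𝓝 0, (φ w : Fin N → ℝ) = φ₀ w := by
    filter_upwards [hφ₀X] with w hw
    simp [φ, hw]
  have hφ0 : φ 0 = a := Subtype.ext (by rw [hφ.self_of_nhds, hφ₀0])
  refine ⟨φ, hφ0, hφ₀an.congr (hφ.mono fun _ => Eq.symm), ⟨u, hu, ?_⟩, fun q hq => ?_⟩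
  · filter_upwards [hφ, hφ₀u] with w h1 h2
    rwa [h1]
  obtain ⟨n, G, hG, hG0, hqG⟩ := exists_leadingForm hu hh hspan hq
  refine ⟨G, hG0, fun v hv => ?_⟩
  obtain ⟨j, hj, z, hz, hjz⟩ := Submodule.mem_sup.1 hqG
  have hlin : Filter.Tendsto (fun t : ℝ => t • v) (𝓝 0) (𝓝 0) := by
    have : Continuous fun t : ℝ => t • v := by fun_prop
    simpa using this.tendsto 0
  have hγ : DifferentiableAt ℝ (fun t : ℝ => φ₀ (t • v)) 0 := by
    refine DifferentiableAt.comp (g := φ₀) 0 ?_ (by fun_prop)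
    rw [zero_smul]
    exact hφ₀an.differentiableAt
  have hz' : (fun t : ℝ => eval (φ₀ (t • v)) z) =O[𝓝 0] fun t => t ^ (n + 1) :=
    isBigO_eval_comp hγ (by rw [zero_smul, hφ₀0]; exact hz)
  have hlt : (fun t : ℝ => t ^ (n + 1)) =o[𝓝 0] fun t => t ^ n :=
    Asymptotics.isLittleO_pow_pow (Nat.lt_succ_self n)
  have hz'' := (hz'.trans_isLittleO hlt).def (c := |eval v G| / 2) (by positivity)
  have hev : ∀ᶠ t in 𝓝 (0 : ℝ), t ≠ 0 → eval (φ (t • v) : Fin N → ℝ) q ≠ 0 := by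
    filter_upwards [hz'', hlin.eventually hφ, hlin.eventually hφ₀u, hlin.eventually hφ₀h]
      with t h1 h2 h3 h4 ht hq0
    rw [h2] at hq0
    have h5 := congrArg (eval (φ₀ (t • v))) hjz
    have h6 : eval (φ₀ (t • v)) (aeval u G) = t ^ n * eval v G := by
      have h7 : eval (φ₀ (t • v)) (aeval u G) = eval (fun i => eval (φ₀ (t • v)) (u i)) G := by
        rw [← aeval_eq_eval, ← aeval_eq_eval, ← AlgHom.comp_apply, comp_aeval]
      rw [h7, ← eval_smul_of_isHomogeneous hG]
      congr 2
      ext i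
      exact h3 i
    rw [map_add, h4 j hj, map_sub, hq0, h6] at h5
    have h8 : eval (φ₀ (t • v)) z = - (t ^ n * eval v G) := by linear_combination h5
    rw [h8, norm_neg, norm_mul, Real.norm_eq_abs (eval v G)] at h1
    have h9 : 0 < ‖t ^ n‖ := norm_pos_iff.2 (pow_ne_zero _ ht)
    have h10 : 0 < |eval v G| := abs_pos.2 hv
    nlinarith
  exact eventually_nhdsWithin_iff.2 hev

/-! ### Taylor expansions along lines -/

/-- The restrictions of `G` to almost all lines through the origin have a Taylor expansion up to
`O(t ^ n)`, whose coefficients are polynomials in the direction vector `v` of the line. -/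
def HasTaylorAlongLines {d : ℕ} (n : ℕ) (G : (Fin d → ℝ) → ℝ) : Prop :=
  ∃ (Q : MvPolynomial (Fin d) ℝ) (p : Polynomial (MvPolynomial (Fin d) ℝ)), Q ≠ 0 ∧
    ∀ v, eval v Q ≠ 0 →
      (fun t : ℝ => G (t • v) - (p.map (eval v)).eval t) =O[𝓝 0] fun t => t ^ n

theorem HasTaylorAlongLines.add {d n : ℕ} {G H : (Fin d → ℝ) → ℝ}
    (hG : HasTaylorAlongLines n G) (hH : HasTaylorAlongLines n H) :
    HasTaylorAlongLines n (G + H) := by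
  obtain ⟨Q, p, hQ, hp⟩ := hG
  obtain ⟨Q', p', hQ', hp'⟩ := hH
  refine ⟨Q * Q', p + p', mul_ne_zero hQ hQ', fun v hv => ?_⟩
  rw [map_mul] at hv
  refine ((hp v (left_ne_zero_of_mul hv)).add (hp' v (right_ne_zero_of_mul hv))).congr_left ?_
  intro t
  simp only [Pi.add_apply, Polynomial.map_add, Polynomial.eval_add]
  ring

/-- A Taylor polynomial of a function vanishing at the origin has no constant term. -/
theorem isBigO_eval_of_sub_isBigO {g : ℝ → ℝ} (hg : g 0 = 0) {n : ℕ} {p : Polynomial ℝ}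
    (h : (fun t : ℝ => g t - p.eval t) =O[𝓝 0] fun t => t ^ (n + 1)) :
    (fun t => p.eval t) =O[𝓝 0] fun t : ℝ => t := by
  -- at `t = 0` the error term vanishes, so `p` takes the value `g 0`
  obtain ⟨c, hc⟩ := h.bound
  have h0 := hc.self_of_nhds
  simp only [hg, zero_sub, norm_neg, ne_eq, Nat.add_eq_zero_iff, one_ne_zero, and_false,
    not_false_eq_true, zero_pow, norm_zero, mul_zero, norm_le_zero_iff] at h0
  simpa [h0] using (p.differentiable.differentiableAt (x := 0)).isBigO_sub

/-- For functions vanishing at the origin, multiplication improves the error term by one order. -/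
theorem HasTaylorAlongLines.mul {d n : ℕ} {G H : (Fin d → ℝ) → ℝ}
    (hG : HasTaylorAlongLines (n + 1) G) (hH : HasTaylorAlongLines (n + 1) H)
    (hG0 : G 0 = 0) (hH0 : H 0 = 0) : HasTaylorAlongLines (n + 2) (G * H) := by
  obtain ⟨Q, p, hQ, hp⟩ := hG
  obtain ⟨Q', p', hQ', hp'⟩ := hH
  refine ⟨Q * Q', p * p', mul_ne_zero hQ hQ', fun v hv => ?_⟩
  rw [map_mul] at hv
  have h1 := hp v (left_ne_zero_of_mul hv)
  have h2 := hp' v (right_ne_zero_of_mul hv)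
  have h3 := isBigO_eval_of_sub_isBigO (by simpa using hG0) h1
  have h4 := isBigO_eval_of_sub_isBigO (by simpa using hH0) h2
  have hpow : (fun t : ℝ => t ^ (n + 1)) =O[𝓝 0] fun t : ℝ => t := by
    simpa [pow_succ] using ((continuous_pow n).continuousAt (x := (0 : ℝ)).isBigO_one ℝ).mul
      (Asymptotics.isBigO_refl (fun t : ℝ => t) (𝓝 0))
  have h5 : (fun t : ℝ => G (t • v)) =O[𝓝 0] fun t : ℝ => t := by
    simpa using (h1.trans hpow).add h3
  refine ((h5.mul h2).add (h4.mul h1)).congr (fun t => ?_) fun t => ?_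
  · simp only [Pi.mul_apply, Polynomial.map_mul, Polynomial.eval_mul]
    ring
  · ring

/-- The derivatives along lines of a function of class `𝓒ᵏ` are polynomials in the direction of
the line. -/
theorem exists_iteratedDeriv_eq_eval {d k j : ℕ} {H : (Fin d → ℝ) → ℝ} (hH : ContDiffAt ℝ k H 0)
    (hj : j ≤ k) : ∃ P : MvPolynomial (Fin d) ℝ,
      ∀ v, iteratedDeriv j (fun t : ℝ => H (t • v)) 0 = eval v P := by
  classical
  obtain ⟨U', hU', hHU'⟩ := hH.contDiffOn le_rfl (by simp)
  obtain ⟨U, hUU', hU, h0⟩ := mem_nhds_iff.1 (show U' ∈ 𝓝 0 by simpa using hU')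
  have hHU := hHU'.mono hUU'
  let M := iteratedFDerivWithin ℝ j H U 0
  refine ⟨∑ r : Fin j → Fin d, C (M fun s => Pi.single (r s) 1) * ∏ s, X (r s), fun v => ?_⟩
  let g : ℝ →L[ℝ] (Fin d → ℝ) := ContinuousLinearMap.toSpanSingleton ℝ v
  have hg : (fun t : ℝ => H (t • v)) = H ∘ g := by
    ext t; simp [g]
  have hgU : IsOpen (g ⁻¹' U) := hU.preimage g.continuous
  have h0g : (0 : ℝ) ∈ g ⁻¹' U := by simpa using h0
  have h1 := g.iteratedFDerivWithin_comp_right hHU hU.uniqueDiffOn hgU.uniqueDiffOn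
    (x := 0) h0g (i := j) (by exact_mod_cast hj)
  rw [iteratedDeriv_eq_iteratedFDeriv, hg, ← iteratedFDerivWithin_of_isOpen j hgU h0g, h1]
  have h2 : (iteratedFDerivWithin ℝ j H U (g 0)).compContinuousLinearMap (fun _ => g)
      (fun _ => 1) = M fun _ => ∑ i, v i • (Pi.single i 1 : Fin d → ℝ) := by
    rw [ContinuousMultilinearMap.compContinuousLinearMap_apply]
    have h3 : g 1 = ∑ i, v i • (Pi.single i 1 : Fin d → ℝ) := by
      rw [← pi_eq_sum_univ' v]
      simp [g]
    simp only [map_zero, h3, M]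
  rw [h2, ContinuousMultilinearMap.map_sum]
  simp only [ContinuousMultilinearMap.map_smul_univ, smul_eq_mul, map_sum, map_mul, eval_C,
    map_prod, eval_X]
  exact Finset.sum_congr rfl fun r _ => mul_comm _ _

/-- Analyticity along a line improves the Taylor remainder `o(t ^ k)` of a function of class `𝓒ᵏ` to
`O(t ^ (k + 1))`. -/
theorem hasTaylorAlongLines_of_analyticAt {d k : ℕ} {G H : (Fin d → ℝ) → ℝ}
    (hGH : G =ᶠ[𝓝 0] H) (hH : ContDiffAt ℝ k H 0) {Q : MvPolynomial (Fin d) ℝ} (hQ : Q ≠ 0)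
    (han : ∀ v, eval v Q ≠ 0 → AnalyticAt ℝ (fun t : ℝ => H (t • v)) 0) :
    HasTaylorAlongLines (k + 1) G := by
  have hP : ∀ j : Fin (k + 1), ∃ P : MvPolynomial (Fin d) ℝ,
      ∀ v, iteratedDeriv j (fun t : ℝ => H (t • v)) 0 = eval v P :=
    fun j => exists_iteratedDeriv_eq_eval hH (Nat.lt_succ_iff.1 j.2)
  choose P hP using hP
  refine ⟨Q, ∑ j : Fin (k + 1), Polynomial.C (C (((j : ℕ).factorial : ℝ)⁻¹) * P j) *
    Polynomial.X ^ (j : ℕ), hQ, fun v hv => ?_⟩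
  have h1 := (han v hv).hasFPowerSeriesAt.isBigO_sub_partialSum_pow (k + 1)
  have h2 : (fun t : ℝ => ‖t‖ ^ (k + 1)) =O[𝓝 0] fun t : ℝ => t ^ (k + 1) := by
    simpa using (Asymptotics.isBigO_refl (fun t : ℝ => t ^ (k + 1)) (𝓝 0)).norm_left
  refine (h1.trans h2).congr' ?_ Filter.EventuallyEq.rfl
  have hlin : Filter.Tendsto (fun t : ℝ => t • v) (𝓝 0) (𝓝 0) := by
    have : Continuous fun t : ℝ => t • v := by fun_prop
    simpa using this.tendsto 0
  filter_upwards [hlin.eventually hGH] with t ht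
  rw [ht, zero_add, FormalMultilinearSeries.partialSum, Finset.sum_range, Polynomial.map_sum,
    Polynomial.eval_finsetSum]
  congr 1
  refine Finset.sum_congr rfl fun j _ => ?_
  rw [FormalMultilinearSeries.ofScalars_apply_eq, hP]
  simp [div_eq_inv_mul]

/-- Regulous functions have Taylor expansions along lines, with error `O(t ^ (k + 1))`: they are
of class `𝓒ᵏ`, and analytic along almost every line because they are rational. -/
theorem hasTaylorAlongLines_of_mem_regulousRing {N d k : ℕ} {X : Set (Fin N → ℝ)}
    {φ : (Fin d → ℝ) → X} (hφ : AnalyticAt ℝ (fun w => (φ w : Fin N → ℝ)) 0)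
    (hq : ∀ q, DenseNonvanishing X q → ∃ Q : MvPolynomial (Fin d) ℝ, Q ≠ 0 ∧
        ∀ v, eval v Q ≠ 0 → ∀ᶠ t in 𝓝[≠] (0 : ℝ), eval (φ (t • v) : Fin N → ℝ) q ≠ 0)
    {f : X → ℝ} (hf : f ∈ regulousRing k X) : HasTaylorAlongLines (k + 1) (f ∘ φ) := by
  obtain ⟨⟨p, q, hqd, hpq⟩, hCk⟩ := hf
  obtain ⟨F, hF, hfF⟩ := hCk (φ 0)
  obtain ⟨Q, hQ0, hQ⟩ := hq q hqd
  have hφc : ContinuousAt φ 0 := Topology.IsInducing.subtypeVal.continuousAt_iff.2 hφ.continuousAt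
  have hGH : f ∘ φ =ᶠ[𝓝 0] fun w => F (φ w) := hφc.eventually hfF
  have hH : ContDiffAt ℝ k (fun w => F (φ w)) 0 :=
    ContDiffAt.comp (g := F) 0 hF (hφ.contDiffAt)
  refine hasTaylorAlongLines_of_analyticAt hGH hH hQ0 fun v hv => ?_
  have hlin : AnalyticAt ℝ (fun t : ℝ => t • v) 0 := by fun_prop
  have hlin0 : Filter.Tendsto (fun t : ℝ => t • v) (𝓝 0) (𝓝 0) := by
    simpa using hlin.continuousAt.tendsto
  have hφv : AnalyticAt ℝ (fun t : ℝ => (φ (t • v) : Fin N → ℝ)) 0 := by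
    refine AnalyticAt.comp (g := fun w => (φ w : Fin N → ℝ)) ?_ hlin
    rwa [zero_smul]
  have hev : ∀ r : MvPolynomial (Fin N) ℝ,
      AnalyticAt ℝ (fun t : ℝ => eval (φ (t • v) : Fin N → ℝ) r) 0 := fun r =>
    AnalyticAt.comp (g := fun x => eval x r) (analyticAt_eval _ r) hφv
  refine MeromorphicAt.analyticAt ?_ ?_
  · refine ((hev p).meromorphicAt.div (hev q).meromorphicAt).congr ?_
    filter_upwards [hQ v hv, (hlin0.eventually hGH).filter_mono nhdsWithin_le_nhds] with t h1 h2
    rw [← h2]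
    exact (hpq _ h1).symm
  · refine ContinuousAt.comp (g := fun w => F (φ w)) ?_ hlin.continuousAt
    rw [zero_smul]
    exact hH.continuousAt

/-! ### Quotients by powers of the distance function -/

section TestFunctions

variable {N : ℕ} (a : Fin N → ℝ)

/-- The squared Euclidean distance to `a`, as a polynomial. -/
def sqDist : MvPolynomial (Fin N) ℝ := ∑ i, (X i - C (a i)) ^ 2

theorem eval_sqDist (x : Fin N → ℝ) : eval x (sqDist a) = ∑ i, (x i - a i) ^ 2 := by
  simp [sqDist]

theorem sqDist_mem : sqDist a ∈ maxIdealAt a ^ 2 :=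
  Ideal.sum_mem _ fun i _ => Ideal.pow_mem_pow (by simp [mem_maxIdealAt]) 2

variable {a}

theorem eval_sqDist_ne_zero {x : Fin N → ℝ} (hx : x ≠ a) : eval x (sqDist a) ≠ 0 := by
  rw [eval_sqDist, Ne, Finset.sum_eq_zero_iff_of_nonneg fun i _ => sq_nonneg _]
  intro h
  refine hx (funext fun i => ?_)
  simpa [sub_eq_zero] using h i (Finset.mem_univ i)

theorem norm_sq_le_eval_sqDist (x : Fin N → ℝ) : ‖x - a‖ ^ 2 ≤ eval x (sqDist a) := by
  have h0 : 0 ≤ eval x (sqDist a) := by rw [eval_sqDist]; positivity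
  have : ‖x - a‖ ≤ Real.sqrt (eval x (sqDist a)) := by
    rw [pi_norm_le_iff_of_nonneg (Real.sqrt_nonneg _)]
    intro i
    rw [Real.norm_eq_abs, ← Real.sqrt_sq_eq_abs]
    refine Real.sqrt_le_sqrt ?_
    rw [eval_sqDist]
    exact Finset.single_le_sum (f := fun i => (x i - a i) ^ 2) (fun i _ => sq_nonneg _)
      (Finset.mem_univ i)
  calc ‖x - a‖ ^ 2 ≤ Real.sqrt (eval x (sqDist a)) ^ 2 := by gcongr
    _ = _ := Real.sq_sqrt h0

theorem pderiv_mem_pow (i : Fin N) {n : ℕ} {z : MvPolynomial (Fin N) ℝ}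
    (hz : z ∈ maxIdealAt a ^ (n + 1)) : pderiv i z ∈ maxIdealAt a ^ n := by
  induction n generalizing z with
  | zero => simp
  | succ n ih =>
    rw [pow_succ'] at hz
    refine Submodule.mul_induction_on hz (fun x hx y hy => ?_) fun x y hx hy => ?_
    · rw [Derivation.leibniz, smul_eq_mul, smul_eq_mul]
      refine Ideal.add_mem _ ?_ (Ideal.mul_mem_right _ _ hy)
      rw [pow_succ']
      exact Ideal.mul_mem_mul hx (ih hy)
    · rw [map_add]; exact Ideal.add_mem _ hx hy

theorem isBigO_div_sqDist {j m : ℕ} {z : MvPolynomial (Fin N) ℝ}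
    (hz : z ∈ maxIdealAt a ^ (2 * j + m)) :
    (fun x => eval x z / eval x (sqDist a) ^ j) =O[𝓝 a] fun x => ‖x - a‖ ^ m := by
  obtain ⟨c, hc⟩ := (isBigO_eval hz).bound
  have hc' : ∀ᶠ x in 𝓝 a, ‖eval x z‖ ≤ |c| * ‖x - a‖ ^ (2 * j + m) := by
    filter_upwards [hc] with x hx
    rw [norm_pow, norm_norm] at hx
    exact hx.trans (by gcongr; exact le_abs_self c)
  refine Asymptotics.IsBigO.of_bound |c| ?_
  filter_upwards [hc'] with x hx
  rw [norm_pow, norm_norm, norm_div, norm_pow]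
  have h0 : 0 ≤ eval x (sqDist a) := (sq_nonneg _).trans (norm_sq_le_eval_sqDist x)
  rw [Real.norm_of_nonneg h0]
  refine div_le_of_le_mul₀ (by positivity) (by positivity) (hx.trans ?_)
  rw [pow_add, pow_mul, mul_assoc, mul_comm (_ ^ j)]
  gcongr
  exact norm_sq_le_eval_sqDist x

/-- The partial derivatives of `z / |x - a| ^ (2 * j)` are again of this form, with the order of the
numerator minus that of the denominator reduced by one. At `x = a` both sides are zero by the
convention `0 / 0 = 0`, or because the numerator vanishes when `j = 0`. -/
theorem hasFDerivAt_div_sqDist {j m : ℕ} {z : MvPolynomial (Fin N) ℝ}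
    (hz : z ∈ maxIdealAt a ^ (2 * j + (m + 2))) (x : Fin N → ℝ) :
    HasFDerivAt (fun x => eval x z / eval x (sqDist a) ^ j)
      (∑ i, (eval x (pderiv i z * sqDist a - (j : MvPolynomial (Fin N) ℝ) * z *
        pderiv i (sqDist a)) / eval x (sqDist a) ^ (j + 1)) •
        (ContinuousLinearMap.proj i : (Fin N → ℝ) →L[ℝ] ℝ)) x := by
  by_cases hx : x = a
  · subst hx
    have h1 : eval x z = 0 := mem_maxIdealAt.1 (Ideal.pow_le_self (by omega) hz)
    have h2 : eval x (sqDist x) = 0 :=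
      mem_maxIdealAt.1 (Ideal.pow_le_self (by omega) (sqDist_mem x))
    simp only [map_sub, map_mul, h1, h2, mul_zero, zero_mul, sub_zero, zero_div, zero_smul,
      Finset.sum_const_zero]
    rw [hasFDerivAt_iff_isLittleO]
    simp only [h1, zero_div, sub_zero, zero_apply]
    refine (isBigO_div_sqDist hz).trans_isLittleO ?_
    have h3 : (fun y : Fin N → ℝ => ‖y - x‖ ^ (m + 2)) =o[𝓝 x] fun y => ‖y - x‖ ^ 1 := by
      refine (Asymptotics.isLittleO_pow_pow (𝕜 := ℝ) (show 1 < m + 2 by omega)).comp_tendsto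
        (k := fun y : Fin N → ℝ => ‖y - x‖) ?_
      have : Continuous fun y : Fin N → ℝ => ‖y - x‖ := by fun_prop
      simpa using this.tendsto x
    simpa using h3
  · have hne := eval_sqDist_ne_zero hx
    have hi : HasDerivAt (fun y : ℝ => (y ^ j)⁻¹) _ (eval x (sqDist a)) :=
      (hasDerivAt_pow j _).fun_inv (pow_ne_zero j hne)
    have hd := (hasFDerivAt_eval x z).mul (hi.comp_hasFDerivAt x (hasFDerivAt_eval x (sqDist a)))
    refine (hd.congr_fderiv ?_ : HasFDerivAt (fun y => eval y z * (eval y (sqDist a) ^ j)⁻¹) _ x)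
    ext v
    simp only [smul_apply, add_apply, Function.comp_apply,
      sum_apply, ContinuousLinearMap.proj_apply, smul_eq_mul, grad_apply,
      map_sub, map_mul, map_natCast, Finset.mul_sum, ← Finset.sum_add_distrib]
    refine Finset.sum_congr rfl fun i _ => ?_
    rcases j with _ | j
    · simp only [pow_zero, Nat.cast_zero]
      field_simp
      ring
    · simp only [Nat.add_sub_cancel]
      field_simp
      ring

/-- A quotient `z / |x - a| ^ (2 * j)` is of class `𝓒ᵏ` if the order of the numerator at `a` exceeds
that of the denominator by at least `k + 1`. -/
theorem contDiff_div_sqDist (k : ℕ) {j : ℕ} {z : MvPolynomial (Fin N) ℝ}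
    (hz : z ∈ maxIdealAt a ^ (2 * j + (k + 1))) :
    ContDiff ℝ k (fun x => eval x z / eval x (sqDist a) ^ j) := by
  induction k generalizing j z with
  | zero =>
    rw [Nat.cast_zero, contDiff_zero, continuous_iff_continuousAt]
    intro x
    by_cases hx : x = a
    · subst hx
      have h1 : eval x z = 0 := mem_maxIdealAt.1 (Ideal.pow_le_self (by omega) hz)
      rw [ContinuousAt, h1, zero_div]
      refine (isBigO_div_sqDist hz).trans_tendsto ?_
      have : Continuous fun y : Fin N → ℝ => ‖y - x‖ ^ (0 + 1) := by fun_prop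
      simpa using this.tendsto x
    · exact (z.continuous_eval.continuousAt).div
        ((sqDist a).continuous_eval.continuousAt.pow j) (pow_ne_zero j (eval_sqDist_ne_zero hx))
  | succ k ih =>
    push_cast
    rw [contDiff_succ_iff_hasFDerivAt]
    refine ⟨_, ?_, hasFDerivAt_div_sqDist hz⟩
    refine ContDiff.sum fun i _ => ContDiff.smul (ih (Ideal.sub_mem _ ?_ ?_)) contDiff_const
    · rw [show 2 * (j + 1) + (k + 1) = (2 * j + (k + 1)) + 2 by ring, pow_add]
      exact Ideal.mul_mem_mul (pderiv_mem_pow i hz) (sqDist_mem a)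
    · rw [show 2 * (j + 1) + (k + 1) = (2 * j + (k + 1 + 1)) + 1 by ring, pow_succ, mul_assoc]
      refine Ideal.mul_mem_left _ _ (Ideal.mul_mem_mul hz ?_)
      simpa using pderiv_mem_pow i (n := 1) (sqDist_mem a)

end TestFunctions

/-! ### The square of the ideal of a point -/

/-- Evaluation of regulous functions at a point. -/
def evalRegulous {N : ℕ} (k : ℕ) {X : Set (Fin N → ℝ)} (a : X) : regulousRing k X →ₐ[ℝ] ℝ :=
  (Pi.evalAlgHom ℝ (fun _ : X => ℝ) a).comp (regulousRing k X).val

/-- If `m` is a finitely generated ideal with residue field `ℝ`, then `m / m ^ 2` has finite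
dimension. -/
theorem exists_sum_smul_mem_sq_of_fg {A : Type*} [CommRing A] [Algebra ℝ A] (ε : A →ₐ[ℝ] ℝ)
    (hfg : (RingHom.ker ε).FG) {g : ℕ → A} (hg : ∀ j, ε (g j) = 0) :
    ∃ (s : Finset ℕ) (c : ℕ → ℝ), (∃ i ∈ s, c i ≠ 0) ∧
      ∑ i ∈ s, c i • g i ∈ RingHom.ker ε * RingHom.ker ε := by
  set m := RingHom.ker ε with hm
  obtain ⟨S, hS⟩ := hfg
  let π := Submodule.mkQ ((m * m).restrictScalars ℝ)
  let W := Submodule.span ℝ (π '' (S : Set A))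
  have hW : ∀ x ∈ m, π x ∈ W := by
    intro x hx
    rw [← hS] at hx
    refine Submodule.span_induction (p := fun x _ => π x ∈ W) (fun x hx => ?_) ?_
      (fun x y _ _ hx hy => ?_) (fun b x hxm hx => ?_) hx
    · exact Submodule.subset_span ⟨x, hx, rfl⟩
    · rw [map_zero]; exact Submodule.zero_mem _
    · rw [map_add]; exact Submodule.add_mem _ hx hy
    · -- `b * x` and `ε b * x` agree modulo `m ^ 2`
      have h1 : π (b • x) = ε b • π x := by
        rw [← map_smul, ← sub_eq_zero, ← map_sub]
        rw [Submodule.mkQ_apply, Submodule.Quotient.mk_eq_zero]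
        have h2 : b • x - ε b • x = (b - algebraMap ℝ A (ε b)) * x := by
          rw [sub_mul, smul_eq_mul, Algebra.smul_def]
        rw [h2]
        have hxm' : x ∈ m := by rw [← hS]; exact hxm
        refine Ideal.mul_mem_mul ?_ hxm'
        rw [hm, RingHom.mem_ker, map_sub, AlgHom.commutes]
        simp
      rw [h1]
      exact Submodule.smul_mem _ _ hx
  have : Module.Finite ℝ W := Module.Finite.span_of_finite ℝ (S.finite_toSet.image π)
  have hnot : ¬ LinearIndependent ℝ (fun j => (⟨π (g j), hW _ (hg j)⟩ : W)) := by
    intro hli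
    exact not_finite_iff_infinite.2 (inferInstance : Infinite ℕ) hli.finite
  rw [linearIndependent_iff'] at hnot
  push Not at hnot
  obtain ⟨s, c, hc, hi⟩ := hnot
  refine ⟨s, c, hi, ?_⟩
  have h1 := congrArg W.subtype hc
  rw [map_sum, map_zero] at h1
  have h2 : π (∑ i ∈ s, c i • g i) = 0 := by
    rw [map_sum, ← h1]
    refine Finset.sum_congr rfl fun i _ => ?_
    rw [map_smul, map_smul]
    rfl
  rwa [Submodule.mkQ_apply, Submodule.Quotient.mk_eq_zero] at h2

/-- Elements of the square of the ideal of a point have Taylor expansions along lines with error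
`O(t ^ (k + 2))`, one order better than general regulous functions. -/
theorem hasTaylorAlongLines_of_mem_ker_mul_ker {N d k : ℕ} {X : Set (Fin N → ℝ)}
    {φ : (Fin d → ℝ) → X}
    (hφ : ∀ f ∈ regulousRing k X, HasTaylorAlongLines (k + 1) (f ∘ φ))
    {f : regulousRing k X}
    (hf : f ∈ RingHom.ker (evalRegulous k (φ 0)) * RingHom.ker (evalRegulous k (φ 0))) :
    HasTaylorAlongLines (k + 2) (f.1 ∘ φ) := by
  refine Submodule.mul_induction_on hf (fun x hx y hy => ?_) fun x y hx hy => ?_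
  · exact (hφ x.1 x.2).mul (hφ y.1 y.2) hx hy
  · exact hx.add hy

/-! ### The test functions -/

/-- If `p / t ^ m` has a finite limit at the origin, this limit is the coefficient of `t ^ m`. -/
theorem coeff_eq_of_tendsto {m : ℕ} {p : Polynomial ℝ} {c : ℝ}
    (h : Filter.Tendsto (fun t => p.eval t / t ^ m) (𝓝[≠] 0) (𝓝 c)) : p.coeff m = c := by
  induction m generalizing p with
  | zero =>
    have h1 : Filter.Tendsto (fun t => p.eval t) (𝓝[≠] 0) (𝓝 (p.eval 0)) :=
      (p.continuous.tendsto 0).mono_left nhdsWithin_le_nhds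
    rw [Polynomial.coeff_zero_eq_eval_zero]
    exact tendsto_nhds_unique h1 (by simpa using h)
  | succ m ih =>
    have h0 : p.eval 0 = 0 := by
      have h1 : Filter.Tendsto (fun t => p.eval t) (𝓝[≠] 0) (𝓝 (p.eval 0)) :=
        (p.continuous.tendsto 0).mono_left nhdsWithin_le_nhds
      have h2 : Filter.Tendsto (fun t : ℝ => t ^ (m + 1)) (𝓝[≠] 0) (𝓝 0) := by
        have : Continuous fun t : ℝ => t ^ (m + 1) := by fun_prop
        simpa using (this.tendsto 0).mono_left (nhdsWithin_le_nhds (s := {0}ᶜ))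
      have h3 := h.mul h2
      rw [mul_zero] at h3
      refine tendsto_nhds_unique h1 (h3.congr' ?_)
      filter_upwards [self_mem_nhdsWithin] with t ht
      exact div_mul_cancel₀ _ (pow_ne_zero _ ht)
    obtain ⟨q, rfl⟩ : Polynomial.X ∣ p := by
      rw [Polynomial.X_dvd_iff, Polynomial.coeff_zero_eq_eval_zero, h0]
    rw [Polynomial.coeff_X_mul]
    refine ih (h.congr' ?_)
    filter_upwards [self_mem_nhdsWithin] with t ht
    rw [Polynomial.eval_mul, Polynomial.eval_X, pow_succ', mul_div_mul_left _ _ ht]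

section Chart

variable {N d : ℕ} {X : Set (Fin N → ℝ)} {φ : (Fin d → ℝ) → X}

/-- The squared Euclidean norm of the derivative of `φ` at the origin, as a quadratic form in the
direction of differentiation. -/
def sqNormDeriv (φ : (Fin d → ℝ) → X) : MvPolynomial (Fin d) ℝ :=
  ∑ k, (∑ i, C (fderiv ℝ (fun w => (φ w : Fin N → ℝ)) 0 (Pi.single i 1) k) * MvPolynomial.X i) ^ 2

theorem eval_sqNormDeriv (v : Fin d → ℝ) :
    eval v (sqNormDeriv φ) = ∑ k, (fderiv ℝ (fun w => (φ w : Fin N → ℝ)) 0 v k) ^ 2 := by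
  simp only [sqNormDeriv, map_sum, map_pow, map_mul, eval_C, eval_X]
  refine Finset.sum_congr rfl fun k _ => ?_
  congr 1
  conv_rhs => rw [pi_eq_sum_univ' v, map_sum]
  simp [mul_comm]

theorem hasDerivAt_line (hφ : AnalyticAt ℝ (fun w => (φ w : Fin N → ℝ)) 0) (v : Fin d → ℝ) :
    HasDerivAt (fun t : ℝ => (φ (t • v) : Fin N → ℝ))
      (fderiv ℝ (fun w => (φ w : Fin N → ℝ)) 0 v) 0 := by
  have h1 : HasDerivAt (fun t : ℝ => t • v) v 0 := by
    simpa using (hasDerivAt_id (0 : ℝ)).smul_const v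
  exact HasFDerivAt.comp_hasDerivAt_of_eq (l := fun w => (φ w : Fin N → ℝ)) 0
    hφ.differentiableAt.hasFDerivAt h1 (by simp)

theorem tendsto_smul_nhds_zero (v : Fin d → ℝ) :
    Filter.Tendsto (fun t : ℝ => t • v) (𝓝 0) (𝓝 0) := by
  have : Continuous fun t : ℝ => t • v := by fun_prop
  simpa using this.tendsto 0

variable {u : Fin d → MvPolynomial (Fin N) ℝ}

/-- The derivative of `φ` is injective, because `u` is inverse to `φ`. -/
theorem eval_sqNormDeriv_ne_zero (hφ : AnalyticAt ℝ (fun w => (φ w : Fin N → ℝ)) 0)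
    (hu : ∀ᶠ w in 𝓝 0, ∀ i, eval (φ w : Fin N → ℝ) (u i) = w i) {v : Fin d → ℝ} (hv : v ≠ 0) :
    eval v (sqNormDeriv φ) ≠ 0 := by
  rw [eval_sqNormDeriv, Ne, Finset.sum_eq_zero_iff_of_nonneg fun k _ => sq_nonneg _]
  intro h
  have hD : fderiv ℝ (fun w => (φ w : Fin N → ℝ)) 0 v = 0 :=
    funext fun k => by simpa using h k (Finset.mem_univ k)
  refine hv (funext fun i => ?_)
  have h1 : HasDerivAt (fun t : ℝ => eval (φ (t • v) : Fin N → ℝ) (u i)) 0 0 := by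
    have := HasFDerivAt.comp_hasDerivAt_of_eq (l := fun x => eval x (u i)) 0
      (hasFDerivAt_eval _ (u i)) (hasDerivAt_line hφ v) rfl
    rwa [hD, map_zero] at this
  have h2 : HasDerivAt (fun t : ℝ => eval (φ (t • v) : Fin N → ℝ) (u i)) (v i) 0 := by
    have h3 : HasDerivAt (fun t : ℝ => t * v i) (v i) 0 := by
      simpa using (hasDerivAt_id (0 : ℝ)).mul_const (v i)
    refine h3.congr_of_eventuallyEq ?_
    filter_upwards [(tendsto_smul_nhds_zero v).eventually hu] with t ht
    rw [ht i]
    rfl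
  exact h2.unique h1

theorem tendsto_sqDist_div (hφ : AnalyticAt ℝ (fun w => (φ w : Fin N → ℝ)) 0)
    (v : Fin d → ℝ) :
    Filter.Tendsto
      (fun t : ℝ => eval (φ (t • v) : Fin N → ℝ) (sqDist (φ 0 : Fin N → ℝ)) / t ^ 2)
      (𝓝[≠] 0) (𝓝 (eval v (sqNormDeriv φ))) := by
  have h1 := hasDerivAt_iff_tendsto_slope_zero.1 (hasDerivAt_line hφ v)
  rw [tendsto_pi_nhds] at h1
  rw [eval_sqNormDeriv]
  refine (tendsto_finsetSum Finset.univ fun k _ => (h1 k).pow 2).congr fun t => ?_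
  rw [eval_sqDist, Finset.sum_div]
  refine Finset.sum_congr rfl fun k _ => ?_
  simp only [zero_add, zero_smul, Pi.smul_apply, Pi.sub_apply, smul_eq_mul]
  rw [mul_pow, inv_pow, mul_comm, div_eq_mul_inv]

/-- The functions `z ^ (2 * j + k + 1) / |x - a| ^ (2 * j)`, where `a = φ 0`. For `z` vanishing at
`a` their value at `a` is `0`, by the convention `0 / 0 = 0` if `j ≠ 0`. -/
def testFunction (φ : (Fin d → ℝ) → X) (k : ℕ) (z : MvPolynomial (Fin N) ℝ) (j : ℕ) : X → ℝ :=
  fun x => eval (x : Fin N → ℝ) (z ^ (2 * j + (k + 1))) /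
    eval (x : Fin N → ℝ) (sqDist (φ 0 : Fin N → ℝ)) ^ j

theorem denseNonvanishing_sqDist_pow (hφ : AnalyticAt ℝ (fun w => (φ w : Fin N → ℝ)) 0)
    (hu0 : ∀ i, u i ∈ maxIdealAt (φ 0 : Fin N → ℝ))
    (hu : ∀ᶠ w in 𝓝 0, ∀ i, eval (φ w : Fin N → ℝ) (u i) = w i) (i₀ : Fin d) (j : ℕ) :
    DenseNonvanishing X (sqDist (φ 0 : Fin N → ℝ) ^ j) := by
  intro r hr
  have hr' : ∀ x ∈ X, x ≠ φ 0 → eval x r = 0 := fun x hx hne => hr x hx (by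
    rw [map_pow]; exact pow_ne_zero _ (eval_sqDist_ne_zero hne))
  intro x hx
  by_cases hxa : x = φ 0
  · subst hxa
    -- the point `φ 0` is a limit of points of `X` along a coordinate line of the chart
    let v : Fin d → ℝ := Pi.single i₀ 1
    have h1 : Filter.Tendsto (fun t : ℝ => eval (φ (t • v) : Fin N → ℝ) r) (𝓝[≠] 0)
        (𝓝 (eval (φ 0 : Fin N → ℝ) r)) := by
      have h2 : ContinuousAt (fun t : ℝ => eval (φ (t • v) : Fin N → ℝ) r) 0 :=
        ContinuousAt.comp (g := fun x => eval x r) r.continuous_eval.continuousAt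
          (hasDerivAt_line hφ v).continuousAt
      simpa using h2.tendsto.mono_left nhdsWithin_le_nhds
    refine tendsto_nhds_unique h1 (tendsto_const_nhds.congr' ?_)
    filter_upwards [self_mem_nhdsWithin,
      ((tendsto_smul_nhds_zero v).eventually hu).filter_mono nhdsWithin_le_nhds] with t ht h3
    refine (hr' _ (φ (t • v)).2 fun h4 => ht ?_).symm
    have h5 := h3 i₀
    rw [h4, mem_maxIdealAt.1 (hu0 i₀)] at h5
    simpa [v] using h5.symm
  · exact hr' x hx hxa

theorem testFunction_mem (hφ : AnalyticAt ℝ (fun w => (φ w : Fin N → ℝ)) 0)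
    (hu0 : ∀ i, u i ∈ maxIdealAt (φ 0 : Fin N → ℝ))
    (hu : ∀ᶠ w in 𝓝 0, ∀ i, eval (φ w : Fin N → ℝ) (u i) = w i) (i₀ : Fin d) (k j : ℕ) :
    testFunction φ k (u i₀) j ∈ regulousRing k X := by
  refine ⟨⟨u i₀ ^ (2 * j + (k + 1)), sqDist (φ 0 : Fin N → ℝ) ^ j,
    denseNonvanishing_sqDist_pow hφ hu0 hu i₀ j, fun x _ => ?_⟩, fun x => ?_⟩
  · rw [map_pow (eval _) (sqDist _)]; rfl
  · exact ⟨_, (contDiff_div_sqDist k (Ideal.pow_mem_pow (hu0 i₀) _)).contDiffAt,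
      Filter.Eventually.of_forall fun x => rfl⟩

/-- The leading coefficient of a test function along the line in direction `v`. -/
theorem tendsto_testFunction_div (hφ : AnalyticAt ℝ (fun w => (φ w : Fin N → ℝ)) 0)
    (hu : ∀ᶠ w in 𝓝 0, ∀ i, eval (φ w : Fin N → ℝ) (u i) = w i) (i₀ : Fin d) (k j : ℕ)
    {v : Fin d → ℝ} (hv : eval v (sqNormDeriv φ) ≠ 0) :
    Filter.Tendsto (fun t : ℝ => testFunction φ k (u i₀) j (φ (t • v)) / t ^ (k + 1)) (𝓝[≠] 0)
      (𝓝 (v i₀ ^ (2 * j + (k + 1)) / eval v (sqNormDeriv φ) ^ j)) := by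
  refine ((tendsto_const_nhds (x := v i₀ ^ (2 * j + (k + 1)))).div
    ((tendsto_sqDist_div hφ v).pow j) (pow_ne_zero j hv)).congr' ?_
  filter_upwards [self_mem_nhdsWithin,
    ((tendsto_smul_nhds_zero v).eventually hu).filter_mono nhdsWithin_le_nhds] with t ht h3
  have ht' : t ≠ 0 := ht
  simp only [Pi.div_apply]
  rw [testFunction, map_pow, h3 i₀, Pi.smul_apply, smul_eq_mul, mul_pow, div_pow, ← pow_mul,
    pow_add t]
  field_simp

end Chart

/-- A quadratic form which is positive outside the origin in at least two variables does not divide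
a power of a variable. -/
theorem not_dvd_X_pow {d : ℕ} {q : MvPolynomial (Fin d) ℝ} {i₀ i₁ : Fin d} (hi : i₀ ≠ i₁)
    (h0 : eval 0 q = 0) (h1 : eval (Pi.single i₁ 1) q ≠ 0) (n : ℕ) :
    ¬ q ∣ (X i₀ : MvPolynomial (Fin d) ℝ) ^ n := by
  intro hdvd
  obtain ⟨s, -, hs⟩ := (dvd_prime_pow (MvPolynomial.X_prime) n).1 hdvd
  have h2 := hs.map (eval (0 : Fin d → ℝ))
  rw [h0, Associated.comm, associated_zero_iff_eq_zero] at h2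
  have h3 := hs.map (eval (Pi.single i₁ 1 : Fin d → ℝ))
  have hs0 : s ≠ 0 := by
    rintro rfl
    simp at h2
  have h4 : eval (Pi.single i₁ 1 : Fin d → ℝ) ((X i₀ : MvPolynomial (Fin d) ℝ) ^ s) = 0 := by
    simp [hi, hs0]
  rw [h4, associated_zero_iff_eq_zero] at h3
  exact h1 h3

/-! ### Finitely generated maximal ideals -/

/-- A nontrivial linear combination of test functions has no Taylor expansion along lines with error
`O(t ^ (k + 2))`: its coefficient of order `k + 1` is not a polynomial in the direction. -/
theorem not_hasTaylorAlongLines_sum {N d k : ℕ} {X : Set (Fin N → ℝ)} {φ : (Fin d → ℝ) → X}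
    {u : Fin d → MvPolynomial (Fin N) ℝ}
    (hφ : AnalyticAt ℝ (fun w => (φ w : Fin N → ℝ)) 0)
    (hu : ∀ᶠ w in 𝓝 0, ∀ i, eval (φ w : Fin N → ℝ) (u i) = w i) {i₀ i₁ : Fin d} (hi : i₀ ≠ i₁)
    {s : Finset ℕ} {c : ℕ → ℝ} (hs : s.Nonempty) (hc : ∀ i ∈ s, c i ≠ 0) :
    ¬ HasTaylorAlongLines (k + 2)
      (fun w => ∑ i ∈ s, c i * testFunction φ k (u i₀) (i + 1) (φ w)) := by
  rintro ⟨Q, p, hQ, hp⟩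
  set q := sqNormDeriv φ with hq
  set j₀ := s.max' hs
  have hq1 : eval (Pi.single i₁ 1) q ≠ 0 := eval_sqNormDeriv_ne_zero hφ hu (by simp)
  have hq0 : eval 0 q = 0 := by rw [hq, eval_sqNormDeriv]; simp
  have hqne : q ≠ 0 := by
    intro h
    rw [h, map_zero] at hq1
    exact hq1 rfl
  have hcoeff : ∀ v, eval v Q ≠ 0 → eval v q ≠ 0 → eval v (p.coeff (k + 1)) =
      ∑ i ∈ s, c i * (v i₀ ^ (2 * (i + 1) + (k + 1)) / eval v q ^ (i + 1)) := by
    intro v hv hqv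
    rw [← Polynomial.coeff_map]
    refine coeff_eq_of_tendsto ?_
    have h1 := ((hp v hv).trans_isLittleO (Asymptotics.isLittleO_pow_pow
      (show k + 1 < k + 2 by omega))).tendsto_div_nhds_zero.mono_left
        (nhdsWithin_le_nhds (s := {0}ᶜ))
    have h2 := tendsto_finsetSum s fun i _ =>
      (tendsto_testFunction_div hφ hu i₀ k (i + 1) hqv).const_mul (c i)
    have h3 := h2.sub h1
    rw [sub_zero] at h3
    refine h3.congr fun t => ?_
    simp only [← mul_div_assoc, ← Finset.sum_div]
    rw [← sub_div, sub_sub_cancel]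
  have hid : ∑ i ∈ s, C (c i) * MvPolynomial.X i₀ ^ (2 * (i + 1) + (k + 1)) * q ^ (j₀ - i) =
      p.coeff (k + 1) * q ^ (j₀ + 1) := by
    refine mul_left_cancel₀ (mul_ne_zero hQ hqne) (MvPolynomial.funext fun v => ?_)
    rw [map_mul, map_mul, map_mul (eval v) (Q * q), map_mul (eval v) Q]
    by_cases hv : eval v Q = 0
    · simp [hv]
    by_cases hqv : eval v q = 0
    · simp [hqv]
    congr 1
    rw [map_mul, hcoeff v hv hqv, Finset.sum_mul, map_sum]
    refine Finset.sum_congr rfl fun i hi => ?_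
    have hle : i ≤ j₀ := s.le_max' i hi
    simp only [map_mul, map_pow, eval_C, eval_X]
    have h4 : eval v q ^ (j₀ + 1) = eval v q ^ (j₀ - i) * eval v q ^ (i + 1) := by
      rw [← pow_add]; congr 1; omega
    rw [h4]
    field_simp
  -- in `hid` every term except that of the largest index `j₀` is visibly divisible by `q`
  have hdvd : q ∣ C (c j₀) * MvPolynomial.X i₀ ^ (2 * (j₀ + 1) + (k + 1)) := by
    have hmem : j₀ ∈ s := s.max'_mem hs
    rw [← Finset.add_sum_erase s _ hmem, Nat.sub_self, pow_zero, mul_one] at hid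
    rw [← dvd_add_left (c := ∑ i ∈ s.erase j₀,
      C (c i) * MvPolynomial.X i₀ ^ (2 * (i + 1) + (k + 1)) * q ^ (j₀ - i)), hid]
    · exact Dvd.dvd.mul_left (dvd_pow_self q (Nat.succ_ne_zero _)) _
    · refine Finset.dvd_sum fun i hi => Dvd.dvd.mul_left (dvd_pow_self q ?_) _
      rw [Finset.mem_erase] at hi
      have := s.le_max' i hi.2
      omega
  have hunit : IsUnit (C (c j₀) : MvPolynomial (Fin d) ℝ) :=
    (IsUnit.mk0 _ (hc j₀ (s.max'_mem hs))).map C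
  exact not_dvd_X_pow hi hq0 hq1 _ (hunit.dvd_mul_left.1 hdvd)

theorem ker_evalRegulous_not_fg {k N d : ℕ} {X : Set (Fin N → ℝ)} (hX : IsAlgebraicSet X)
    (hsmooth : IsSmooth X) (hdim : dim X = d) (hd : 2 ≤ d) (a : X) :
    ¬ (RingHom.ker (evalRegulous k a)).FG := by
  intro hfg
  obtain ⟨hreg, hdima⟩ := hsmooth a
  rw [hdim] at hdima
  obtain ⟨φ, rfl, hφ, ⟨u, hu0, hu⟩, hQ⟩ := exists_chart hX a hdima
  let i₀ : Fin d := ⟨0, by omega⟩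
  let i₁ : Fin d := ⟨1, by omega⟩
  have hi : i₀ ≠ i₁ := by simp [i₀, i₁]
  let g : ℕ → regulousRing k X := fun j =>
    ⟨testFunction φ k (u i₀) (j + 1), testFunction_mem hφ hu0 hu i₀ k (j + 1)⟩
  have hg : ∀ j, evalRegulous k (φ 0) (g j) = 0 := by
    intro j
    change testFunction φ k (u i₀) (j + 1) (φ 0) = 0
    rw [testFunction, map_pow, mem_maxIdealAt.1 (hu0 i₀), zero_pow (by omega), zero_div]
  obtain ⟨s, c, ⟨i, his, hci⟩, hmem⟩ := exists_sum_smul_mem_sq_of_fg (evalRegulous k (φ 0)) hfg hg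
  have hT := hasTaylorAlongLines_of_mem_ker_mul_ker
    (fun f hf => hasTaylorAlongLines_of_mem_regulousRing hφ hQ hf) hmem
  refine not_hasTaylorAlongLines_sum (k := k) (s := s.filter fun i => c i ≠ 0) (c := c) hφ hu hi
    ⟨i, Finset.mem_filter.2 ⟨his, hci⟩⟩ (fun i hi => (Finset.mem_filter.1 hi).2) ?_
  convert hT using 1
  ext w
  rw [Function.comp_apply, AddSubmonoidClass.coe_finsetSum, Finset.sum_apply]
  refine Finset.sum_filter_of_ne fun i _ h0 hc0 => h0 ?_
  rw [hc0, zero_mul]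

theorem inv_mem_regulousRing {k N : ℕ} {X : Set (Fin N → ℝ)} {f : X → ℝ}
    (hf : f ∈ regulousRing k X) (h0 : ∀ x, f x ≠ 0) : f⁻¹ ∈ regulousRing k X := by
  obtain ⟨⟨p, q, hq, hpq⟩, hCk⟩ := hf
  have hp : DenseNonvanishing X p := fun r hr => hq r fun x hx hqx => hr x hx fun hp => by
    have := hpq ⟨x, hx⟩ hqx
    rw [hp, zero_div] at this
    exact h0 _ this
  -- `q / p` itself need not equal `1 / f` where `q` vanishes, so the fraction is expanded by `q`
  refine ⟨⟨q * q, p * q, dense_mul hp hq, fun x hx => ?_⟩, fun a => ?_⟩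
  · rw [map_mul] at hx
    have hqx := right_ne_zero_of_mul hx
    rw [Pi.inv_apply, hpq x hqx, inv_div, map_mul, map_mul, mul_div_mul_right _ _ hqx]
  · obtain ⟨F, hF, hfF⟩ := hCk a
    refine ⟨fun x => (F x)⁻¹, hF.inv ?_, hfF.mono fun x hx => by rw [Pi.inv_apply, hx]⟩
    rw [← hfF.self_of_nhds]
    exact h0 a

/-- A proper finitely generated ideal has a common zero: otherwise the sum of the squares of its
generators is a unit. -/
theorem exists_le_ker_evalRegulous {k N : ℕ} {X : Set (Fin N → ℝ)}
    {M : Ideal (regulousRing k X)} (hM : M ≠ ⊤) (hfg : M.FG) :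
    ∃ a : X, M ≤ RingHom.ker (evalRegulous k a) := by
  obtain ⟨S, rfl⟩ := hfg
  by_contra! hcon
  refine hM ((Ideal.eq_top_iff_one _).2 ?_)
  set f := ∑ g ∈ S, g * g with hf
  have hfM : f ∈ Ideal.span (S : Set (regulousRing k X)) :=
    Ideal.sum_mem _ fun g hg => Ideal.mul_mem_left _ _ (Ideal.subset_span hg)
  have hne : ∀ x, f.1 x ≠ 0 := by
    intro x hx
    refine hcon x (Ideal.span_le.2 fun g hg => ?_)
    have h1 : evalRegulous k x f = 0 := hx
    rw [hf, map_sum] at h1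
    simp only [map_mul] at h1
    rw [Finset.sum_eq_zero_iff_of_nonneg fun g _ => mul_self_nonneg _] at h1
    exact mul_self_eq_zero.1 (h1 g hg)
  have h1 : (1 : regulousRing k X) = ⟨f.1⁻¹, inv_mem_regulousRing f.2 hne⟩ * f := by
    refine Subtype.ext (funext fun x => ?_)
    exact (inv_mul_cancel₀ (hne x)).symm
  rw [h1]
  exact Ideal.mul_mem_left _ _ hfM

theorem nonempty_of_dim_eq {N d : ℕ} {X : Set (Fin N → ℝ)} (hdim : dim X = d) : X.Nonempty := by
  by_contra! hX
  have : Subsingleton (CoordRing X) := by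
    refine Ideal.Quotient.subsingleton_iff.2 ?_
    rw [Ideal.eq_top_iff_one, mem_vanishingIdeal_iff_eval, hX]
    simp
  rw [dim, ringKrullDim_eq_bot_of_subsingleton] at hdim
  exact WithBot.bot_ne_coe hdim

theorem isMaximal_not_fg {k N d : ℕ} {X : Set (Fin N → ℝ)} (hX : IsAlgebraicSet X)
    (hsmooth : IsSmooth X) (hdim : dim X = d) (hd : 2 ≤ d) {M : Ideal (regulousRing k X)}
    (hM : M.IsMaximal) : ¬ M.FG := by
  intro hfg
  obtain ⟨a, ha⟩ := exists_le_ker_evalRegulous hM.ne_top hfg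
  have := hM.eq_of_le (RingHom.ker_ne_top (evalRegulous k a)) ha
  rw [this] at hfg
  exact ker_evalRegulous_not_fg hX hsmooth hdim hd a hfg

end Regulous

end

theorem theorem4p10 (k N d : ℕ) (X : Set (Fin N → ℝ))
    (hX : Regulous.IsAlgebraicSet X)
    (hsmooth : Regulous.IsSmooth X)
    (hdim : Regulous.dim X = d)
    (hd : 2 ≤ d) :
    (∀ M : Ideal (Regulous.regulousRing k X), M.IsMaximal → ¬ M.FG) ∧
      ¬ IsNoetherianRing (Regulous.regulousRing k X) := by
  have h := fun (M : Ideal (Regulous.regulousRing k X)) (hM : M.IsMaximal) =>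
    Regulous.isMaximal_not_fg (k := k) hX hsmooth hdim hd hM
  refine ⟨h, fun hnoeth => ?_⟩
  obtain ⟨a, ha⟩ := Regulous.nonempty_of_dim_eq hdim
  have : Nontrivial (Regulous.regulousRing k X) :=
    (Regulous.evalRegulous k (⟨a, ha⟩ : X)).toRingHom.domain_nontrivial
  obtain ⟨M, hM⟩ := Ideal.exists_maximal (Regulous.regulousRing k X)
  exact h M hM (IsNoetherian.noetherian M)
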